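/- Let $(M,g)$ be a connected noncompact $C^\infty$ Riemannian manifold without boundary of dimension $n\ge 2$, with Riemannian distance $d$, all of whose geodesics (parametrized by arc length) are defined on $\mathbb{R}$. Let $SM$ be its unit tangent bundle, let $\Phi_t(v)=\dot\gamma_v(t)$ ($v\in SM$, $t\in\mathbb{R}$) be the geodesic flow, where $\gamma_v$ is the geodesic with $\dot\gamma_v(0)=v$, and let $\tilde d$ be the distance on $SM$ of the Riemannian metric induced on $SM\subset TM$ by the Sasaki metric $\langle\xi,\eta\rangle=g(d\pi\,\xi,d\pi\,\eta)+g(K\xi,K\eta)$, where $\pi:TM\to M$ is the projection and $K$ is the connection map of the Levi-Civita connection. Suppose that the geodesic flow is pointwise equicontinuous with respect to $\tilde d$: for every $v\in SM$ and $\varepsilon>0$ there is $\delta>0$ such that for all $w\in SM$ with $\tilde d(v,w)<\delta$ we have $\tilde d(\Phi_t(v),\Phi_t(w))<\varepsilon$ for all $t\in\mathbb{R}$. Then: 1. There is no line (minimal geodesic) in $M$, that is, no geodesic $\gamma:\mathbb{R}\to M$ with $d(\gamma(s),\gamma(t))=|s-t|$ for all $s,t\in\mathbb{R}$. 2. There is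 a function $C:M\to\mathbb{R}$, bounded above on every compact subset of $M$, such that for all $x\in M$ and all $r$ the metric sphere $\partial B(x,r)=\{y\in M : d(x,y)=r\}$ satisfies $\operatorname{diam}\partial B(x,r)=\sup\{d(y,z) : y,z\in\partial B(x,r)\}\le C(x)$. -/

import Mathlib

open Set Bundle Manifold MeasureTheory
open scoped ContDiff Topology ENNReal RealInnerProductSpace

noncomputable section

namespace RiemGeom

variable {n : ℕ} {M : Type*} [TopologicalSpace M] [ChartedSpace (EuclideanSpace ℝ (Fin n)) M]
  [IsManifold (𝓡 n) ∞ M] [RiemannianBundle (fun x : M => TangentSpace (𝓡 n) x)]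

/-- The matrix `g_{ij}(y)` of the Riemannian metric in the preferred chart `φ` around `p`, as a
bilinear form on the model space: `u, w ↦ g(dφ⁻¹ u, dφ⁻¹ w)` at the point `φ⁻¹ y`. -/
def chartMetric (n : ℕ) {M : Type*} [TopologicalSpace M]
    [ChartedSpace (EuclideanSpace ℝ (Fin n)) M] [IsManifold (𝓡 n) ∞ M]
    [RiemannianBundle (fun x : M => TangentSpace (𝓡 n) x)] (p : M)
    (y : EuclideanSpace ℝ (Fin n)) :
    EuclideanSpace ℝ (Fin n) →L[ℝ] EuclideanSpace ℝ (Fin n) →L[ℝ] ℝ :=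
  let q : M := (extChartAt (𝓡 n) p).symm y
  let A : EuclideanSpace ℝ (Fin n) →L[ℝ] TangentSpace (𝓡 n) q :=
    (trivializationAt (EuclideanSpace ℝ (Fin n)) (TangentSpace (𝓡 n)) p).symmL ℝ q
  (innerSL ℝ (E := TangentSpace (𝓡 n) q)).bilinearComp A A

/-- The linear form `w ↦ ½ (∂_u g(w, v) + ∂_v g(u, w) - ∂_w g(u, v))` at `p`, in the preferred chart
around `p` (Christoffel symbols of the first kind). -/
def koszulForm (n : ℕ) {M : Type*} [TopologicalSpace M]
    [ChartedSpace (EuclideanSpace ℝ (Fin n)) M] [IsManifold (𝓡 n) ∞ M]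
    [RiemannianBundle (fun x : M => TangentSpace (𝓡 n) x)] (p : M)
    (u v : EuclideanSpace ℝ (Fin n)) : EuclideanSpace ℝ (Fin n) →L[ℝ] ℝ :=
  let D := fderiv ℝ (chartMetric n p) (extChartAt (𝓡 n) p p)
  (1 / 2 : ℝ) • ((D u).flip v + D v u - (D.flip u).flip v)

/-- The Christoffel symbol `Γ(u, v) = Γ^k_{ij} uⁱ vʲ ∂_k` of the Levi-Civita connection at `p`, in
the preferred chart around `p`: the vector that represents `koszulForm n p u v` with respect to the
Riemannian inner product (in that chart `T_p M` is identified with the model space). -/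
def christoffel (p : M) (u v : TangentSpace (𝓡 n) p) : TangentSpace (𝓡 n) p :=
  haveI : FiniteDimensional ℝ (TangentSpace (𝓡 n) p) :=
    inferInstanceAs (FiniteDimensional ℝ (EuclideanSpace ℝ (Fin n)))
  haveI : CompleteSpace (TangentSpace (𝓡 n) p) := FiniteDimensional.complete ℝ _
  (InnerProductSpace.toDual ℝ (TangentSpace (𝓡 n) p)).symm (koszulForm n p u v)

/-- The connection map `K : T_v(TM) → T_{π v} M` of the Levi-Civita connection. A vector tangent
to `TM` at `v` is read in the preferred chart of `TM` at `v` as a pair `(a, b)`; then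
`K (a, b) = b + Γ(a, v)`. If `V` is a curve in `TM`, then `K (V')` is the covariant derivative of
the vector field `V` along its foot point curve. -/
def connectionMap (v : TangentBundle (𝓡 n) M) (ξ : TangentSpace (𝓡 n).tangent v) :
    TangentSpace (𝓡 n) v.proj :=
  let a : TangentSpace (𝓡 n) v.proj := ξ.1
  let b : TangentSpace (𝓡 n) v.proj := ξ.2
  b + christoffel v.proj a v.2

/-- The differential `dπ : T_v(TM) → T_{π v} M` of the canonical projection `π : TM → M`. -/
def dproj (v : TangentBundle (𝓡 n) M) (ξ : TangentSpace (𝓡 n).tangent v) :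
    TangentSpace (𝓡 n) v.proj :=
  mfderiv (𝓡 n).tangent (𝓡 n) (fun w : TangentBundle (𝓡 n) M => w.proj) v ξ

/-- The Sasaki metric on `TM`: `⟨ξ, η⟩ = g(dπ ξ, dπ η) + g(K ξ, K η)`. -/
def sasakiInner (v : TangentBundle (𝓡 n) M) (ξ η : TangentSpace (𝓡 n).tangent v) : ℝ :=
  inner ℝ (dproj v ξ) (dproj v η) + inner ℝ (connectionMap v ξ) (connectionMap v η)

/-- The norm of the Sasaki metric. -/
def sasakiNorm (v : TangentBundle (𝓡 n) M) (ξ : TangentSpace (𝓡 n).tangent v) : ℝ :=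
  √(sasakiInner v ξ ξ)

variable (n M) in
/-- The unit tangent bundle `SM`. -/
abbrev UnitTangentBundle : Type _ := {v : TangentBundle (𝓡 n) M // ‖v.2‖ = 1}

/-- The Sasaki length of a curve in `TM` defined on `[0, 1]`. -/
def sasakiLength (c : ℝ → TangentBundle (𝓡 n) M) : ℝ≥0∞ :=
  ∫⁻ t in Icc (0 : ℝ) 1,
    ENNReal.ofReal (sasakiNorm (c t) (mfderiv 𝓘(ℝ, ℝ) (𝓡 n).tangent c t (1 : ℝ)))

/-- The distance on `SM` of the Riemannian metric that the Sasaki metric induces on `SM`: the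
infimum of the Sasaki lengths of the `C¹` curves in `SM` from `v` to `w`. -/
def sasakiEDist (v w : UnitTangentBundle n M) : ℝ≥0∞ :=
  ⨅ (c : ℝ → TangentBundle (𝓡 n) M)
    (_ : ContMDiffOn 𝓘(ℝ, ℝ) (𝓡 n).tangent 1 c (Icc 0 1)
      ∧ (∀ t ∈ Icc (0 : ℝ) 1, ‖(c t).2‖ = 1) ∧ c 0 = v.1 ∧ c 1 = w.1),
    sasakiLength c

/-- The velocity of a curve in `M`, as a curve in `TM`. -/
def velocity (n : ℕ) {M : Type*} [TopologicalSpace M]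
    [ChartedSpace (EuclideanSpace ℝ (Fin n)) M] (γ : ℝ → M) (t : ℝ) : TangentBundle (𝓡 n) M :=
  ⟨γ t, mfderiv 𝓘(ℝ, ℝ) (𝓡 n) γ t (1 : ℝ)⟩

/-- Geodesics `γ : ℝ → M` parametrized by arc length: `γ` is smooth, `|γ'| = 1`, and the
covariant derivative of `γ'` along `γ` vanishes. -/
structure IsGeodesic (n : ℕ) {M : Type*} [TopologicalSpace M]
    [ChartedSpace (EuclideanSpace ℝ (Fin n)) M] [IsManifold (𝓡 n) ∞ M]
    [RiemannianBundle (fun x : M => TangentSpace (𝓡 n) x)] (γ : ℝ → M) : Prop where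
  smooth : ContMDiff 𝓘(ℝ, ℝ) (𝓡 n) ∞ γ
  unit_speed : ∀ t, ‖(velocity n γ t).2‖ = 1
  covDeriv_eq_zero : ∀ t, connectionMap (velocity n γ t)
    (mfderiv 𝓘(ℝ, ℝ) (𝓡 n).tangent (velocity n γ) t (1 : ℝ)) = 0

/-- `Φ` is the (complete) geodesic flow on `SM`: for each `v` there is a geodesic `γ_v : ℝ → M`
with `γ_v'(0) = v`, and `Φ_t(v) = γ_v'(t)`. Such a `Φ` is unique, and it exists if and only if `M`
is geodesically complete. -/
def IsGeodesicFlow (Φ : ℝ → UnitTangentBundle n M → UnitTangentBundle n M) : Prop :=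
  ∀ v : UnitTangentBundle n M, ∃ γ : ℝ → M,
    IsGeodesic n γ ∧ velocity n γ 0 = v.1 ∧ ∀ t, (Φ t v).1 = velocity n γ t

/-- A line (minimal geodesic): a geodesic `γ : ℝ → M` that realizes the distance between any two
of its points. -/
def IsLine (n : ℕ) {M : Type*} [MetricSpace M]
    [ChartedSpace (EuclideanSpace ℝ (Fin n)) M] [IsManifold (𝓡 n) ∞ M]
    [RiemannianBundle (fun x : M => TangentSpace (𝓡 n) x)] (γ : ℝ → M) : Prop :=
  IsGeodesic n γ ∧ ∀ s t : ℝ, dist (γ s) (γ t) = |s - t|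

/-- Pointwise equicontinuity of a system `(X, ℝ)` with respect to the distance `d`. -/
def PointwiseEquicontinuous {X : Type*} (d : X → X → ℝ≥0∞) (Φ : ℝ → X → X) : Prop :=
  ∀ x : X, ∀ ε > 0, ∃ δ > 0, ∀ y : X, d x y < δ → ∀ t : ℝ, d (Φ t x) (Φ t y) < ε

end RiemGeom

end

/-!
Let `r > 0`. By the theorem of Hopf and Rinow, every point at distance `r` from `x` is of the form
`π (Φ_r v)` with `v` in the unit sphere `S_x M`. So the diameter of the metric sphere is at most
that of `S_x M` for the pseudodistance `D v w = sup_t d (π Φ_t v, π Φ_t w)`. Now `D` is locally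
bounded on `SM`: `π` is 1-Lipschitz for the Sasaki distance, the flow is equicontinuous, and the
Sasaki distance is continuous for the manifold topology. Since `S_x M` is compact and, for
`n ≥ 2`, connected, `D` is bounded on it, locally uniformly in `x`. A line `γ` would have the points
`γ (±r)`, at distance `2 r`, on the sphere of radius `r` about `γ 0`.

For the theorem of Hopf and Rinow, let `q` on a small sphere about `x` be at minimal distance from
`y`, and let `γ` be the geodesic from `x` through `q`. If `γ` stopped approaching `y` at unit speed,
a minimal geodesic from the last good point towards `y` would form a minimal curve with the segment
of `γ` that precedes it. Such a curve has no corner: the points at distance `s` on either side of a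
corner with unit velocities `v` and `w` are at distance `s |v + w| + o(s)`, and `|v + w| < 2` for
`v ≠ w`. That points near `x` are reached by geodesics in a time equal to their distance follows
from the first variation of energy, by which the squared norm of the inverse exponential map
satisfies the eikonal inequality.
-/

noncomputable section

namespace RiemGeom

set_option maxSynthPendingDepth 3

local notation:max "𝔼" n:max => EuclideanSpace ℝ (Fin n)

section TangentCoordinates

variable {n : ℕ} {M : Type*} [TopologicalSpace M] [ChartedSpace (𝔼 n) M]

theorem extChartAt_symm_mem_source {p : M} {y : 𝔼 n} (hy : y ∈ (extChartAt (𝓡 n) p).target) :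
    (extChartAt (𝓡 n) p).symm y ∈ (chartAt (𝔼 n) p).source := by
  simpa only [extChartAt_source] using (extChartAt (𝓡 n) p).map_target hy

theorem extChartAt_symm_extChartAt {p q : M} (hq : q ∈ (chartAt (𝔼 n) p).source) :
    (extChartAt (𝓡 n) p).symm (extChartAt (𝓡 n) p q) = q :=
  (extChartAt (𝓡 n) p).left_inv (by simpa only [extChartAt_source] using hq)

variable [IsManifold (𝓡 n) ∞ M]

/-- The components of a tangent vector in the preferred chart around `p`. -/
def tangentCoord (p : M) (V : TangentBundle (𝓡 n) M) : 𝔼 n :=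
  (trivializationAt (𝔼 n) (TangentSpace (𝓡 n)) p V).2

/-- The tangent vector with components `u` at the point with coordinates `y` in the preferred chart
around `p`; a junk value unless `y` lies in the target of that chart. -/
def ofCoord (p : M) (y u : 𝔼 n) : TangentBundle (𝓡 n) M :=
  ⟨(extChartAt (𝓡 n) p).symm y,
    (trivializationAt (𝔼 n) (TangentSpace (𝓡 n)) p).symmL ℝ ((extChartAt (𝓡 n) p).symm y) u⟩

theorem tangentCoord_symmL {p q : M} (hq : q ∈ (chartAt (𝔼 n) p).source) (u : 𝔼 n) :
    tangentCoord p ⟨q, (trivializationAt (𝔼 n) (TangentSpace (𝓡 n)) p).symmL ℝ q u⟩ = u := by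
  rw [tangentCoord, Trivialization.symmL_apply _ hq, Trivialization.apply_mk_symm _ hq]

theorem symmL_tangentCoord {p q : M} (hq : q ∈ (chartAt (𝔼 n) p).source)
    (X : TangentSpace (𝓡 n) q) :
    (trivializationAt (𝔼 n) (TangentSpace (𝓡 n)) p).symmL ℝ q (tangentCoord p ⟨q, X⟩) = X := by
  rw [tangentCoord, Trivialization.symmL_apply _ hq]
  exact Trivialization.symm_apply_apply_mk _ hq X

theorem tangentCoord_self (q : M) (X : TangentSpace (𝓡 n) q) : tangentCoord q ⟨q, X⟩ = X :=
  tangentCoordChange_self (I := 𝓡 n) (mem_extChartAt_source q)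

theorem tangentCoord_eq_coordChange (p q : M) (X : TangentSpace (𝓡 n) q) :
    tangentCoord p ⟨q, X⟩ = tangentCoordChange (𝓡 n) q p q X := rfl

theorem tangentCoord_change {p q : M} {V : TangentBundle (𝓡 n) M}
    (hp : V.proj ∈ (chartAt (𝔼 n) p).source) (hq : V.proj ∈ (chartAt (𝔼 n) q).source) :
    tangentCoord q V = tangentCoordChange (𝓡 n) p q V.proj (tangentCoord p V) := by
  refine (tangentCoordChange_comp (I := 𝓡 n) (v := V.2) ?_).symm
  simp only [extChartAt_source, mem_inter_iff, mem_chart_source, hp, hq, and_self]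

theorem tangentCoord_ofCoord {p : M} {y : 𝔼 n} (hy : y ∈ (extChartAt (𝓡 n) p).target) (u : 𝔼 n) :
    tangentCoord p (ofCoord p y u) = u :=
  tangentCoord_symmL (extChartAt_symm_mem_source hy) u

theorem ofCoord_tangentCoord {p : M} {V : TangentBundle (𝓡 n) M}
    (hp : V.proj ∈ (chartAt (𝔼 n) p).source) :
    ofCoord p (extChartAt (𝓡 n) p V.proj) (tangentCoord p V) = V := by
  obtain ⟨q, X⟩ := V
  rw [ofCoord, extChartAt_symm_extChartAt hp, symmL_tangentCoord hp]

end TangentCoordinates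

section ChartMetric

variable {n : ℕ} {M : Type*} [TopologicalSpace M] [ChartedSpace (𝔼 n) M] [IsManifold (𝓡 n) ∞ M]
  [RiemannianBundle (fun x : M => TangentSpace (𝓡 n) x)]

theorem chartMetric_apply (p : M) (y a b : 𝔼 n) :
    chartMetric n p y a b = inner ℝ (ofCoord p y a).2 (ofCoord p y b).2 := rfl

theorem inner_eq_chartMetric {p q : M} (hq : q ∈ (chartAt (𝔼 n) p).source)
    (X Y : TangentSpace (𝓡 n) q) :
    inner ℝ X Y = chartMetric n p (extChartAt (𝓡 n) p q) (tangentCoord p ⟨q, X⟩)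
      (tangentCoord p ⟨q, Y⟩) := by
  rw [chartMetric, extChartAt_symm_extChartAt hq]
  simp only [ContinuousLinearMap.bilinearComp_apply, symmL_tangentCoord hq, innerSL_apply_apply]

theorem chartMetric_symm (p : M) (y a b : 𝔼 n) : chartMetric n p y a b = chartMetric n p y b a := by
  exact real_inner_comm (F := TangentSpace (𝓡 n) ((extChartAt (𝓡 n) p).symm y)) _ _

theorem chartMetric_self (p : M) (y a : 𝔼 n) : chartMetric n p y a a = ‖(ofCoord p y a).2‖ ^ 2 := by
  exact real_inner_self_eq_norm_sq (F := TangentSpace (𝓡 n) ((extChartAt (𝓡 n) p).symm y)) _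

theorem chartMetric_pos {p : M} {y a : 𝔼 n} (hy : y ∈ (extChartAt (𝓡 n) p).target) (ha : a ≠ 0) :
    0 < chartMetric n p y a a := by
  rw [chartMetric_apply]
  refine real_inner_self_pos.2 fun h => ha ?_
  rw [← tangentCoord_ofCoord hy a, ← tangentCoord_ofCoord hy 0]
  simp only [ofCoord] at h ⊢
  rw [h, map_zero]
  rfl

theorem norm_sq_eq_chartMetric {p : M} {V : TangentBundle (𝓡 n) M}
    (hp : V.proj ∈ (chartAt (𝔼 n) p).source) :
    ‖V.2‖ ^ 2 =
      chartMetric n p (extChartAt (𝓡 n) p V.proj) (tangentCoord p V) (tangentCoord p V) := by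
  rw [← real_inner_self_eq_norm_sq]
  exact inner_eq_chartMetric hp V.2 V.2

theorem chartMetric_change {p q x : M} (hp : x ∈ (chartAt (𝔼 n) p).source)
    (hq : x ∈ (chartAt (𝔼 n) q).source) (a b : 𝔼 n) :
    chartMetric n p (extChartAt (𝓡 n) p x) a b = chartMetric n q (extChartAt (𝓡 n) q x)
      (tangentCoordChange (𝓡 n) p q x a) (tangentCoordChange (𝓡 n) p q x b) := by
  set e := trivializationAt (𝔼 n) (TangentSpace (𝓡 n) : M → Type _) p
  have coord_eq (c : 𝔼 n) :
      tangentCoord q ⟨x, e.symmL ℝ x c⟩ = tangentCoordChange (𝓡 n) p q x c := by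
    rw [tangentCoord_change (V := ⟨x, e.symmL ℝ x c⟩) hp hq, tangentCoord_symmL hp]
  rw [← coord_eq, ← coord_eq, ← inner_eq_chartMetric hq, inner_eq_chartMetric hp,
    tangentCoord_symmL hp, tangentCoord_symmL hp]

theorem contDiffOn_chartMetric
    [IsContMDiffRiemannianBundle (𝓡 n) ∞ (𝔼 n) (fun x : M => TangentSpace (𝓡 n) x)] (p : M) :
    ContDiffOn ℝ ∞ (chartMetric n p) (extChartAt (𝓡 n) p).target := by
  set e := trivializationAt (𝔼 n) (TangentSpace (𝓡 n) : M → Type _) p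
  have frame_smooth (a : 𝔼 n) : ContMDiffOn (𝓡 n) (𝓡 n).tangent ∞
      (fun q : M => (⟨q, e.symmL ℝ q a⟩ : TangentBundle (𝓡 n) M)) e.baseSet :=
    (e.contMDiffOn_section_baseSet_iff (IB := 𝓡 n)).2 <|
      (contMDiffOn_const (c := a)).congr fun q hq => tangentCoord_symmL hq a
  refine contDiffOn_clm_apply.2 fun a => contDiffOn_clm_apply.2 fun b => ?_
  rw [← contMDiffOn_iff_contDiffOn]
  exact ((frame_smooth a).inner_bundle (IB := 𝓡 n) (F := 𝔼 n) (frame_smooth b)).comp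
    (contMDiffOn_extChartAt_symm p) fun y hy => extChartAt_symm_mem_source hy

end ChartMetric

section Koszul

variable {E : Type*} [NormedAddCommGroup E] [NormedSpace ℝ E]

/-- The Christoffel symbols of the first kind, `w ↦ ½ (∂_u g(w, v) + ∂_v g(u, w) - ∂_w g(u, v))`,
of a metric `g` whose derivative at the point considered is `D`. -/
def koszul (D : E →L[ℝ] E →L[ℝ] E →L[ℝ] ℝ) (u v : E) : E →L[ℝ] ℝ :=
  (1 / 2 : ℝ) • ((D u).flip v + D v u - (D.flip u).flip v)

theorem koszul_apply (D : E →L[ℝ] E →L[ℝ] E →L[ℝ] ℝ) (u v w : E) :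
    koszul D u v w = (D u w v + D v u w - D w u v) / 2 := by
  simp only [koszul, smul_apply, sub_apply, add_apply, ContinuousLinearMap.flip_apply, smul_eq_mul]
  ring

theorem hasDerivAt_clm_comp_apply {F : Type*} [NormedAddCommGroup F] [NormedSpace ℝ F]
    {T : E → E →L[ℝ] F} {T' : E →L[ℝ] E →L[ℝ] F} {y u : ℝ → E} {y' u' : E} {t : ℝ}
    (hT : HasFDerivAt T T' (y t)) (hy : HasDerivAt y y' t) (hu : HasDerivAt u u' t) :
    HasDerivAt (fun s => T (y s) (u s)) (T' y' (u t) + T (y t) u') t :=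
  (HasFDerivAt.comp_hasDerivAt (E := E →L[ℝ] F) t hT hy).clm_apply hu

theorem fderiv_pullback_metric_apply {G H : E → E →L[ℝ] E →L[ℝ] ℝ} {τ : E → E} {T : E → E →L[ℝ] E}
    {T' : E →L[ℝ] E →L[ℝ] E} {D D' : E →L[ℝ] E →L[ℝ] E →L[ℝ] ℝ} {y : E}
    (hG : HasFDerivAt G D y) (hH : HasFDerivAt H D' (τ y)) (hτ : HasFDerivAt τ (T y) y)
    (hT : HasFDerivAt T T' y) (hGH : ∀ᶠ x in 𝓝 y, ∀ a b, G x a b = H (τ x) (T x a) (T x b))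
    (c a b : E) :
    D c a b = D' (T y c) (T y a) (T y b) + H (τ y) (T' c a) (T y b) + H (τ y) (T y a) (T' c b) := by
  have deriv_left : HasFDerivAt (fun x => G x a b) ((D.flip a).flip b) y := by
    convert! (hG.clm_apply (hasFDerivAt_const a y)).clm_apply (hasFDerivAt_const b y) using 1
    ext
    simp
  have deriv_comp : HasFDerivAt (fun x => H (τ x)) (D'.comp (T y)) y :=
    HasFDerivAt.comp (G := E →L[ℝ] E →L[ℝ] ℝ) y hH hτ
  have deriv_right := (deriv_comp.clm_apply (hT.clm_apply (hasFDerivAt_const a y))).clm_apply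
    (hT.clm_apply (hasFDerivAt_const b y))
  have := DFunLike.congr_fun
    (deriv_left.unique (deriv_right.congr_of_eventuallyEq (hGH.mono fun x hx => hx a b))) c
  simp only [ContinuousLinearMap.flip_apply, ContinuousLinearMap.comp_zero, zero_add,
    ContinuousLinearMap.flip_add, add_apply, ContinuousLinearMap.comp_apply] at this
  rw [this]
  ring

theorem koszul_change {G H : E → E →L[ℝ] E →L[ℝ] ℝ} {τ : E → E} {T : E → E →L[ℝ] E}
    {T' : E →L[ℝ] E →L[ℝ] E} {D D' : E →L[ℝ] E →L[ℝ] E →L[ℝ] ℝ} {y : E}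
    (hG : HasFDerivAt G D y) (hH : HasFDerivAt H D' (τ y)) (hτ : HasFDerivAt τ (T y) y)
    (hT : HasFDerivAt T T' y) (hGH : ∀ᶠ x in 𝓝 y, ∀ a b, G x a b = H (τ x) (T x a) (T x b))
    (hT_symm : ∀ a b, T' a b = T' b a) (hH_symm : ∀ a b, H (τ y) a b = H (τ y) b a) (a b w : E) :
    koszul D a b w = koszul D' (T y a) (T y b) (T y w) + H (τ y) (T' a b) (T y w) := by
  simp only [koszul_apply, fderiv_pullback_metric_apply hG hH hτ hT hGH, hT_symm b a, hT_symm w a,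
    hT_symm w b]
  rw [hH_symm (T y w) (T' a b)]
  ring

end Koszul

section ChartTransition

variable {n : ℕ} {M : Type*} [TopologicalSpace M] [ChartedSpace (𝔼 n) M]

variable (n) in
/-- The transition map from the preferred chart around `p` to the preferred chart around `q`. -/
def chartTransition (p q : M) : 𝔼 n → 𝔼 n :=
  extChartAt (𝓡 n) q ∘ (extChartAt (𝓡 n) p).symm

theorem chartTransition_extChartAt {p q x : M} (hp : x ∈ (chartAt (𝔼 n) p).source) :
    chartTransition n p q (extChartAt (𝓡 n) p x) = extChartAt (𝓡 n) q x := by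
  rw [chartTransition, Function.comp_apply, extChartAt_symm_extChartAt hp]

theorem extChartAt_mem_target {p x : M} (hp : x ∈ (chartAt (𝔼 n) p).source) :
    extChartAt (𝓡 n) p x ∈ (extChartAt (𝓡 n) p).target :=
  (extChartAt (𝓡 n) p).map_source (by rwa [extChartAt_source])

theorem eventually_extChartAt_symm_mem_source {p q x : M} (hp : x ∈ (chartAt (𝔼 n) p).source)
    (hq : x ∈ (chartAt (𝔼 n) q).source) :
    ∀ᶠ y in 𝓝 (extChartAt (𝓡 n) p x), y ∈ (extChartAt (𝓡 n) p).target ∧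
      (extChartAt (𝓡 n) p).symm y ∈ (chartAt (𝔼 n) q).source := by
  have target_mem := (isOpen_extChartAt_target (I := 𝓡 n) p).mem_nhds (extChartAt_mem_target hp)
  have symm_tendsto : ContinuousAt (extChartAt (𝓡 n) p).symm (extChartAt (𝓡 n) p x) :=
    continuousAt_extChartAt_symm'' (extChartAt_mem_target hp)
  refine Filter.Eventually.and target_mem (symm_tendsto ((chartAt _ q).open_source.mem_nhds ?_))
  rwa [extChartAt_symm_extChartAt hp]

variable [IsManifold (𝓡 n) ∞ M]

theorem tangentCoordChange_eq_fderiv (p q x : M) : tangentCoordChange (𝓡 n) p q x =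
    fderiv ℝ (chartTransition n p q) (extChartAt (𝓡 n) p x) := by
  rw [tangentCoordChange_def, ModelWithCorners.range_eq_univ, fderivWithin_univ, chartTransition]

theorem contDiffAt_chartTransition {p q x : M} (hp : x ∈ (chartAt (𝔼 n) p).source)
    (hq : x ∈ (chartAt (𝔼 n) q).source) :
    ContDiffAt ℝ ∞ (chartTransition n p q) (extChartAt (𝓡 n) p x) := by
  have h := contDiffWithinAt_ext_coord_change (I := 𝓡 n) (n := ∞) q p
    (y := extChartAt (𝓡 n) p x) <| by
      rw [PartialEquiv.trans_source, PartialEquiv.symm_source]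
      refine ⟨extChartAt_mem_target hp, ?_⟩
      rwa [mem_preimage, extChartAt_symm_extChartAt hp, extChartAt_source]
  rwa [ModelWithCorners.range_eq_univ, contDiffWithinAt_univ] at h

theorem hasFDerivAt_chartTransition {p q x : M} (hp : x ∈ (chartAt (𝔼 n) p).source)
    (hq : x ∈ (chartAt (𝔼 n) q).source) :
    HasFDerivAt (chartTransition n p q) (fderiv ℝ (chartTransition n p q) (extChartAt (𝓡 n) p x))
      (extChartAt (𝓡 n) p x) :=
  ((contDiffAt_chartTransition hp hq).differentiableAt (by decide)).hasFDerivAt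

theorem hasFDerivAt_fderiv_chartTransition {p q x : M} (hp : x ∈ (chartAt (𝔼 n) p).source)
    (hq : x ∈ (chartAt (𝔼 n) q).source) :
    HasFDerivAt (fderiv ℝ (chartTransition n p q))
      (fderiv ℝ (fderiv ℝ (chartTransition n p q)) (extChartAt (𝓡 n) p x))
      (extChartAt (𝓡 n) p x) :=
  (((contDiffAt_chartTransition hp hq).fderiv_right (m := 1) (by norm_cast)).differentiableAt
    one_ne_zero).hasFDerivAt

variable [RiemannianBundle (fun x : M => TangentSpace (𝓡 n) x)]
  [IsContMDiffRiemannianBundle (𝓡 n) ∞ (𝔼 n) (fun x : M => TangentSpace (𝓡 n) x)]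

theorem hasFDerivAt_chartMetric {p : M} {y : 𝔼 n} (hy : y ∈ (extChartAt (𝓡 n) p).target) :
    HasFDerivAt (chartMetric n p) (fderiv ℝ (chartMetric n p) y) y :=
  (((contDiffOn_chartMetric p).contDiffAt
    ((isOpen_extChartAt_target p).mem_nhds hy)).differentiableAt (by decide)).hasFDerivAt

theorem koszul_chartMetric_change {p q x : M} (hp : x ∈ (chartAt (𝔼 n) p).source)
    (hq : x ∈ (chartAt (𝔼 n) q).source) (a b w : 𝔼 n) :
    koszul (fderiv ℝ (chartMetric n p) (extChartAt (𝓡 n) p x)) a b w =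
      koszul (fderiv ℝ (chartMetric n q) (extChartAt (𝓡 n) q x))
        (tangentCoordChange (𝓡 n) p q x a) (tangentCoordChange (𝓡 n) p q x b)
        (tangentCoordChange (𝓡 n) p q x w) +
      chartMetric n q (extChartAt (𝓡 n) q x)
        (fderiv ℝ (fderiv ℝ (chartTransition n p q)) (extChartAt (𝓡 n) p x) a b)
        (tangentCoordChange (𝓡 n) p q x w) := by
  have transition_isometry : ∀ᶠ y in 𝓝 (extChartAt (𝓡 n) p x), ∀ a b, chartMetric n p y a b =
      chartMetric n q (chartTransition n p q y) (fderiv ℝ (chartTransition n p q) y a)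
        (fderiv ℝ (chartTransition n p q) y b) := by
    filter_upwards [eventually_extChartAt_symm_mem_source hp hq] with y ⟨hy, hyq⟩ a b
    have := chartMetric_change (extChartAt_symm_mem_source hy) hyq a b
    rwa [tangentCoordChange_eq_fderiv, (extChartAt (𝓡 n) p).right_inv hy] at this
  have second_symm := (contDiffAt_chartTransition hp hq).isSymmSndFDerivAt
    (by rw [minSmoothness_of_isRCLikeNormedField]; norm_cast)
  have hH := hasFDerivAt_chartMetric (extChartAt_mem_target hq)
  rw [← chartTransition_extChartAt (q := q) hp] at hH ⊢
  rw [tangentCoordChange_eq_fderiv]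
  exact koszul_change (hasFDerivAt_chartMetric (extChartAt_mem_target hp)) hH
    (hasFDerivAt_chartTransition hp hq) (hasFDerivAt_fderiv_chartTransition hp hq)
    transition_isometry second_symm.eq (chartMetric_symm q _) a b w

end ChartTransition

section CurvesInCharts

variable {n : ℕ} {M : Type*} [TopologicalSpace M] [ChartedSpace (𝔼 n) M] [IsManifold (𝓡 n) ∞ M]
  {V : ℝ → TangentBundle (𝓡 n) M} {t : ℝ} {p : M}

theorem hasDerivAt_extChartAt_comp {γ : ℝ → M} (hγ : MDifferentiableAt 𝓘(ℝ, ℝ) (𝓡 n) γ t)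
    (hp : γ t ∈ (chartAt (𝔼 n) p).source) :
    HasDerivAt (F := 𝔼 n) (fun s => extChartAt (𝓡 n) p (γ s)) (tangentCoord p (velocity n γ t))
      t := by
  let L : ℝ →L[ℝ] 𝔼 n := (mfderiv (𝓡 n) 𝓘(ℝ, 𝔼 n) (extChartAt (𝓡 n) p) (γ t)).comp
    (mfderiv 𝓘(ℝ, ℝ) (𝓡 n) γ t)
  have hL : HasFDerivAt (extChartAt (𝓡 n) p ∘ γ) L t := hasMFDerivAt_iff_hasFDerivAt.1 <|
    (mdifferentiableAt_extChartAt (I := 𝓡 n) hp).hasMFDerivAt.comp t hγ.hasMFDerivAt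
  convert! hL.hasDerivAt using 1
  have := mfderiv_chartAt_eq_tangentCoordChange (I := 𝓡 n) (y := p) (x := γ t) hp
  exact (DFunLike.congr_fun this (mfderiv 𝓘(ℝ, ℝ) (𝓡 n) γ t (1 : ℝ))).symm

variable (V t) in
/-- The velocity at time `t` of a curve `V` in `TM`, in the preferred chart of `TM` at `V t`. -/
def tangentVelocity : 𝔼 n × 𝔼 n := mfderiv 𝓘(ℝ, ℝ) (𝓡 n).tangent V t (1 : ℝ)

theorem hasDerivAt_chart_self (hV : MDifferentiableAt 𝓘(ℝ, ℝ) (𝓡 n).tangent V t) :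
    HasDerivAt (fun s => (extChartAt (𝓡 n) (V t).proj (V s).proj, tangentCoord (V t).proj (V s)))
      (tangentVelocity V t) t := by
  let L : ℝ →L[ℝ] 𝔼 n × 𝔼 n := mfderiv 𝓘(ℝ, ℝ) (𝓡 n).tangent V t
  have hL : HasFDerivWithinAt
      (fun s => (extChartAt (𝓡 n) (V t).proj (V s).proj, tangentCoord (V t).proj (V s)))
      L univ t := by
    rw [← ModelWithCorners.range_eq_univ 𝓘(ℝ, ℝ)]
    exact hV.hasMFDerivAt.2
  exact (hasFDerivWithinAt_univ.1 hL).hasDerivAt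

theorem hasDerivAt_extChartAt_self (hV : MDifferentiableAt 𝓘(ℝ, ℝ) (𝓡 n).tangent V t) :
    HasDerivAt (fun s => extChartAt (𝓡 n) (V t).proj (V s).proj) (tangentVelocity V t).1 t :=
  (ContinuousLinearMap.fst ℝ (𝔼 n) (𝔼 n)).hasFDerivAt.comp_hasDerivAt t (hasDerivAt_chart_self hV)

theorem hasDerivAt_tangentCoord_self (hV : MDifferentiableAt 𝓘(ℝ, ℝ) (𝓡 n).tangent V t) :
    HasDerivAt (fun s => tangentCoord (V t).proj (V s)) (tangentVelocity V t).2 t :=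
  (ContinuousLinearMap.snd ℝ (𝔼 n) (𝔼 n)).hasFDerivAt.comp_hasDerivAt t (hasDerivAt_chart_self hV)

theorem mdifferentiableAt_proj (hV : MDifferentiableAt 𝓘(ℝ, ℝ) (𝓡 n).tangent V t) :
    MDifferentiableAt 𝓘(ℝ, ℝ) (𝓡 n) (fun s => (V s).proj) t :=
  ((mdifferentiableAt_totalSpace (𝓡 n) V).1 hV).1

theorem dproj_mfderiv (hV : MDifferentiableAt 𝓘(ℝ, ℝ) (𝓡 n).tangent V t) :
    dproj (V t) (mfderiv 𝓘(ℝ, ℝ) (𝓡 n).tangent V t (1 : ℝ)) =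
      mfderiv 𝓘(ℝ, ℝ) (𝓡 n) (fun s => (V s).proj) t (1 : ℝ) := by
  have proj_mdifferentiable : MDifferentiableAt (𝓡 n).tangent (𝓡 n)
      (fun w : TangentBundle (𝓡 n) M => w.proj) (V t) :=
    (contMDiff_proj (IB := 𝓡 n) (n := 1) (TangentSpace (𝓡 n) : M → Type _)).mdifferentiable
      one_ne_zero _
  exact (DFunLike.congr_fun (mfderiv_comp (I' := (𝓡 n).tangent) t proj_mdifferentiable hV)
    (1 : ℝ)).symm

theorem eventually_proj_mem_source (hV : MDifferentiableAt 𝓘(ℝ, ℝ) (𝓡 n).tangent V t)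
    (hp : (V t).proj ∈ (chartAt (𝔼 n) p).source) :
    ∀ᶠ s in 𝓝 t, (V s).proj ∈ (chartAt (𝔼 n) p).source :=
  (mdifferentiableAt_proj hV).continuousAt ((chartAt _ p).open_source.mem_nhds hp)

theorem hasDerivAt_tangentCoord_change {q : M} {y' u' : 𝔼 n}
    (hV : MDifferentiableAt 𝓘(ℝ, ℝ) (𝓡 n).tangent V t)
    (hp : (V t).proj ∈ (chartAt (𝔼 n) p).source) (hq : (V t).proj ∈ (chartAt (𝔼 n) q).source)
    (hy : HasDerivAt (fun s => extChartAt (𝓡 n) p (V s).proj) y' t)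
    (hu : HasDerivAt (fun s => tangentCoord p (V s)) u' t) :
    HasDerivAt (fun s => tangentCoord q (V s))
      (fderiv ℝ (fderiv ℝ (chartTransition n p q)) (extChartAt (𝓡 n) p (V t).proj) y'
          (tangentCoord p (V t)) +
        tangentCoordChange (𝓡 n) p q (V t).proj u') t := by
  rw [tangentCoordChange_eq_fderiv]
  have := hasDerivAt_clm_comp_apply (y := fun s => extChartAt (𝓡 n) p (V s).proj)
    (hasFDerivAt_fderiv_chartTransition hp hq) hy hu
  refine this.congr_of_eventuallyEq ?_
  filter_upwards [eventually_proj_mem_source hV hp, eventually_proj_mem_source hV hq] with s hsp hsq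
  rw [tangentCoord_change hsp hsq, tangentCoordChange_eq_fderiv]

theorem velocity_proj_eq_fst (hV : MDifferentiableAt 𝓘(ℝ, ℝ) (𝓡 n).tangent V t) :
    (velocity n (fun s => (V s).proj) t).2 = (tangentVelocity V t).1 := by
  have := (hasDerivAt_extChartAt_comp (mdifferentiableAt_proj hV)
    (mem_chart_source _ _)).unique (hasDerivAt_extChartAt_self hV)
  rwa [velocity, tangentCoord_self] at this

theorem differentiableAt_tangentCoord (hV : MDifferentiableAt 𝓘(ℝ, ℝ) (𝓡 n).tangent V t)
    (hp : (V t).proj ∈ (chartAt (𝔼 n) p).source) :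
    DifferentiableAt ℝ (fun s => tangentCoord p (V s)) t :=
  (hasDerivAt_tangentCoord_change hV (mem_chart_source _ _) hp (hasDerivAt_extChartAt_self hV)
    (hasDerivAt_tangentCoord_self hV)).differentiableAt

variable [RiemannianBundle (fun x : M => TangentSpace (𝓡 n) x)]

theorem inner_christoffel (p : M) (u v w : TangentSpace (𝓡 n) p) :
    inner ℝ (christoffel p u v) w =
      koszul (fderiv ℝ (chartMetric n p) (extChartAt (𝓡 n) p p)) u v w := by
  have : FiniteDimensional ℝ (TangentSpace (𝓡 n) p) :=
    inferInstanceAs (FiniteDimensional ℝ (𝔼 n))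
  have : CompleteSpace (TangentSpace (𝓡 n) p) := FiniteDimensional.complete ℝ _
  exact InnerProductSpace.toDual_symm_apply

variable [IsContMDiffRiemannianBundle (𝓡 n) ∞ (𝔼 n) (fun x : M => TangentSpace (𝓡 n) x)]

/-- In every chart, and not only in the one that defines it, the connection map of a curve is its
covariant derivative: the second derivative of the transition map cancels. -/
theorem chartMetric_connectionMap {u' : 𝔼 n} (hV : MDifferentiableAt 𝓘(ℝ, ℝ) (𝓡 n).tangent V t)
    (hp : (V t).proj ∈ (chartAt (𝔼 n) p).source)
    (hu : HasDerivAt (fun s => tangentCoord p (V s)) u' t) (w : 𝔼 n) :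
    chartMetric n p (extChartAt (𝓡 n) p (V t).proj) (tangentCoord p ⟨(V t).proj,
        connectionMap (V t) (mfderiv 𝓘(ℝ, ℝ) (𝓡 n).tangent V t (1 : ℝ))⟩) w =
      chartMetric n p (extChartAt (𝓡 n) p (V t).proj) u' w +
      koszul (fderiv ℝ (chartMetric n p) (extChartAt (𝓡 n) p (V t).proj))
        (tangentCoord p (velocity n (fun s => (V s).proj) t)) (tangentCoord p (V t)) w := by
  have hq := mem_chart_source (𝔼 n) (V t).proj
  obtain ⟨w, rfl⟩ : ∃ w' : TangentSpace (𝓡 n) (V t).proj, tangentCoord p ⟨(V t).proj, w'⟩ = w :=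
    ⟨_, tangentCoord_symmL hp w⟩
  let a : TangentSpace (𝓡 n) (V t).proj := (tangentVelocity V t).1
  let b : TangentSpace (𝓡 n) (V t).proj := (tangentVelocity V t).2
  have connectionMap_eq : connectionMap (V t) (mfderiv 𝓘(ℝ, ℝ) (𝓡 n).tangent V t (1 : ℝ)) =
      b + christoffel (V t).proj a (V t).2 := rfl
  have christoffel_eq := (inner_christoffel _ a (V t).2 w).trans
    (koszul_chartMetric_change hq hp (tangentVelocity V t).1 (V t).2 w)
  have velocity_eq : velocity n (fun s => (V s).proj) t = ⟨(V t).proj, a⟩ :=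
    congrArg (TotalSpace.mk (V t).proj) (velocity_proj_eq_fst hV)
  rw [← inner_eq_chartMetric hp, connectionMap_eq, inner_add_left, inner_eq_chartMetric hp b w,
    christoffel_eq, hu.unique (hasDerivAt_tangentCoord_change hV hq hp
      (hasDerivAt_extChartAt_self hV) (hasDerivAt_tangentCoord_self hV)), velocity_eq, map_add,
    add_apply, tangentCoord_self, tangentCoord_eq_coordChange, tangentCoord_eq_coordChange,
    tangentCoord_eq_coordChange, tangentCoord_change hq hp, tangentCoord_self]
  ring

end CurvesInCharts

section ProdCurves

variable {E F : Type*} [NormedAddCommGroup E] [NormedSpace ℝ E] [NormedAddCommGroup F]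
  [NormedSpace ℝ F] {z : ℝ → E × F} {z' : E × F} {t : ℝ}

theorem hasDerivAt_fst (hz : HasDerivAt z z' t) : HasDerivAt (fun s => (z s).1) z'.1 t :=
  (ContinuousLinearMap.fst ℝ E F).hasFDerivAt.comp_hasDerivAt t hz

theorem hasDerivAt_snd (hz : HasDerivAt z z' t) : HasDerivAt (fun s => (z s).2) z'.2 t :=
  (ContinuousLinearMap.snd ℝ E F).hasFDerivAt.comp_hasDerivAt t hz

end ProdCurves

section Spray

variable {E : Type*} [NormedAddCommGroup E] [NormedSpace ℝ E]

/-- A smooth Riemannian metric on an open subset `U` of a vector space. The bilinear forms are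
defined on the whole space, and symmetry is required there too; outside `U` they are otherwise
arbitrary. -/
structure IsMetricOn (G : E → E →L[ℝ] E →L[ℝ] ℝ) (U : Set E) : Prop where
  isOpen : IsOpen U
  contDiffOn : ContDiffOn ℝ ∞ G U
  symm : ∀ x a b, G x a b = G x b a
  pos : ∀ x ∈ U, ∀ a, a ≠ 0 → 0 < G x a a

/-- The acceleration of geodesics as a function of position and velocity. -/
def geodesicAccel (G : E → E →L[ℝ] E →L[ℝ] ℝ) (z : E × E) : E :=
  -(G z.1).inverse (koszul (fderiv ℝ G z.1) z.2 z.2)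

/-- The geodesic spray: the vector field on phase space whose integral curves are the geodesics
together with their velocities. -/
def spray (G : E → E →L[ℝ] E →L[ℝ] ℝ) (z : E × E) : E × E := (z.2, geodesicAccel G z)

variable {G : E → E →L[ℝ] E →L[ℝ] ℝ} {U : Set E} {x : E}

theorem koszul_smul (D : E →L[ℝ] E →L[ℝ] E →L[ℝ] ℝ) (s : ℝ) (u : E) :
    koszul D (s • u) (s • u) = s ^ 2 • koszul D u u := by
  ext w
  simp only [koszul_apply, map_smul, smul_apply, smul_eq_mul]
  ring

theorem geodesicAccel_smul (s : ℝ) (x u : E) :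
    geodesicAccel G (x, s • u) = s ^ 2 • geodesicAccel G (x, u) := by
  simp only [geodesicAccel, koszul_smul, map_smul, smul_neg]

theorem spray_zero (x : E) : spray G (x, 0) = 0 := by
  have h : geodesicAccel G (x, 0) = 0 := by simpa using geodesicAccel_smul (G := G) 0 x 0
  simp only [spray, h, Prod.mk_zero_zero]

theorem hasDerivAt_rescale {z : ℝ → E × E} {k t : ℝ}
    (hz : HasDerivAt z (spray G (z (k * t))) (k * t)) :
    HasDerivAt (fun s => ((z (k * s)).1, k • (z (k * s)).2))
      (spray G ((z (k * t)).1, k • (z (k * t)).2)) t := by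
  have hk : HasDerivAt (fun s => k * s) k t := by simpa using (hasDerivAt_id t).const_mul k
  have h := hz.scomp t hk
  convert! (hasDerivAt_fst h).prodMk ((hasDerivAt_snd h).const_smul k) using 1
  simp only [spray, geodesicAccel_smul, Prod.smul_mk, smul_smul, sq]

namespace IsMetricOn

theorem contDiffAt (hG : IsMetricOn G U) (hx : x ∈ U) : ContDiffAt ℝ ∞ G x :=
  hG.contDiffOn.contDiffAt (hG.isOpen.mem_nhds hx)

theorem hasFDerivAt (hG : IsMetricOn G U) (hx : x ∈ U) : HasFDerivAt G (fderiv ℝ G x) x :=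
  ((hG.contDiffAt hx).differentiableAt (by simp)).hasFDerivAt

theorem contDiffAt_fderiv (hG : IsMetricOn G U) (hx : x ∈ U) : ContDiffAt ℝ ∞ (fderiv ℝ G) x :=
  (hG.contDiffAt hx).fderiv_right (by norm_cast)

theorem nonneg (hG : IsMetricOn G U) (hx : x ∈ U) (a : E) : 0 ≤ G x a a := by
  rcases eq_or_ne a 0 with rfl | ha
  · simp
  · exact (hG.pos x hx a ha).le

theorem cauchySchwarz (hG : IsMetricOn G U) (hx : x ∈ U) (a b : E) :
    (G x a b) ^ 2 ≤ G x a a * G x b b := by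
  have hpoly : ∀ t : ℝ, 0 ≤ G x b b * (t * t) + 2 * G x a b * t + G x a a := fun t => by
    have h := hG.nonneg hx (a + t • b)
    simp only [map_add, map_smul, add_apply, smul_apply, smul_eq_mul, hG.symm x b a] at h
    linarith
  have hdiscrim := discrim_le_zero hpoly
  rw [discrim] at hdiscrim
  linarith

theorem fderiv_symm (hG : IsMetricOn G U) (hx : x ∈ U) (c a b : E) :
    fderiv ℝ G x c a b = fderiv ℝ G x c b a := by
  have h (a b : E) : HasFDerivAt (fun y => G y a b) (((fderiv ℝ G x).flip a).flip b) x := by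
    have hab := ((hG.hasFDerivAt hx).clm_apply (hasFDerivAt_const a x)).clm_apply
      (hasFDerivAt_const b x)
    convert! hab using 1
    ext
    simp
  have hab := h a b
  simp only [hG.symm _ a b] at hab
  exact DFunLike.congr_fun (hab.unique (h b a)) c

theorem koszul_self_apply (hG : IsMetricOn G U) (hx : x ∈ U) (u w : E) :
    koszul (fderiv ℝ G x) u u w = fderiv ℝ G x u u w - fderiv ℝ G x w u u / 2 := by
  rw [koszul_apply, hG.fderiv_symm hx u w u]
  ring

theorem contDiffAt_koszul [FiniteDimensional ℝ E] (hG : IsMetricOn G U) (hx : x ∈ U) (u : E) :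
    ContDiffAt ℝ 1 (fun z : E × E => koszul (fderiv ℝ G z.1) z.2 z.2) (x, u) := by
  have hU : U ×ˢ univ ∈ 𝓝 (x, u) := (hG.isOpen.prod isOpen_univ).mem_nhds ⟨hx, trivial⟩
  refine ContDiffOn.contDiffAt (contDiffOn_clm_apply.2 fun w z hz => ?_) hU
  have hD : ContDiffAt ℝ 1 (fun z : E × E => fderiv ℝ G z.1) z :=
    ((hG.contDiffAt_fderiv hz.1).of_le (by simp)).comp z contDiffAt_fst
  have hu : ContDiffAt ℝ 1 (fun z : E × E => z.2) z := contDiffAt_snd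
  have hw : ContDiffAt ℝ 1 (fun _ : E × E => w) z := contDiffAt_const
  simp only [koszul_apply]
  exact ((((((hD.clm_apply hu).clm_apply hw).clm_apply hu).add
    (((hD.clm_apply hu).clm_apply hu).clm_apply hw)).sub
    (((hD.clm_apply hw).clm_apply hu).clm_apply hu)).div_const 2).contDiffWithinAt

variable [FiniteDimensional ℝ E]

theorem isInvertible (hG : IsMetricOn G U) (hx : x ∈ U) : (G x).IsInvertible := by
  have hinj : Function.Injective (G x) := by
    rw [injective_iff_map_eq_zero]
    intro a ha
    by_contra hne
    have hpos := hG.pos x hx a hne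
    simp [ha] at hpos
  have hdim : Module.finrank ℝ E = Module.finrank ℝ (E →L[ℝ] ℝ) := by
    rw [← (LinearMap.toContinuousLinearMap (𝕜 := ℝ) (E := E) (F' := ℝ)).finrank_eq]
    exact (Subspace.dual_finrank_eq (K := ℝ) (V := E)).symm
  let e : E ≃ₗ[ℝ] (E →L[ℝ] ℝ) := LinearEquiv.ofInjectiveOfFinrankEq (G x).toLinearMap hinj hdim
  exact ⟨e.toContinuousLinearEquiv, by ext; rfl⟩

theorem apply_geodesicAccel (hG : IsMetricOn G U) (hx : x ∈ U) (u w : E) :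
    G x (geodesicAccel G (x, u)) w = -koszul (fderiv ℝ G x) u u w := by
  obtain ⟨e, he⟩ := hG.isInvertible hx
  simp only [geodesicAccel]
  rw [map_neg, ← he, ContinuousLinearMap.inverse_equiv]
  simp

theorem eq_geodesicAccel (hG : IsMetricOn G U) (hx : x ∈ U) {u a : E}
    (h : ∀ w, G x a w = -koszul (fderiv ℝ G x) u u w) : a = geodesicAccel G (x, u) := by
  by_contra hne
  have hpos := hG.pos x hx _ (sub_ne_zero.2 hne)
  rw [map_sub (G x), sub_apply, h, hG.apply_geodesicAccel hx, sub_self] at hpos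
  exact hpos.false

theorem contDiffAt_spray (hG : IsMetricOn G U) (hx : x ∈ U) (u : E) :
    ContDiffAt ℝ 1 (spray G) (x, u) := by
  have hG₁ : ContDiffAt ℝ 1 (fun z : E × E => G z.1) (x, u) :=
    ((hG.contDiffAt hx).of_le (by simp)).comp (x, u) contDiffAt_fst
  obtain ⟨e, he⟩ := hG.isInvertible hx
  have hinv : ContDiffAt ℝ 1 ContinuousLinearMap.inverse (G x) := he ▸ contDiffAt_map_inverse e
  exact contDiffAt_snd.prodMk
    ((ContDiffAt.comp (x, u) hinv hG₁).clm_apply (hG.contDiffAt_koszul hx u)).neg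

theorem fderiv_spray_zero_left (hG : IsMetricOn G U) (hx : x ∈ U) (a : E) :
    fderiv ℝ (spray G) (x, 0) (a, 0) = 0 := by
  have h := ((hG.contDiffAt_spray hx 0).differentiableAt (by simp)).hasFDerivAt
  have hcomp : HasFDerivAt (spray G ∘ fun y : E => (y, (0 : E))) _ x :=
    HasFDerivAt.comp (G := E × E) x h (hasFDerivAt_prodMk_left x (0 : E))
  have hconst : HasFDerivAt (spray G ∘ fun y : E => (y, (0 : E))) (0 : E →L[ℝ] E × E) x := by
    simp only [Function.comp_def, spray_zero]
    exact hasFDerivAt_const _ _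
  exact DFunLike.congr_fun (hcomp.unique hconst) a

theorem fderiv_spray_zero_right (hG : IsMetricOn G U) (hx : x ∈ U) (b : E) :
    fderiv ℝ (spray G) (x, 0) (0, b) = (b, 0) := by
  have h := ((hG.contDiffAt_spray hx 0).differentiableAt (by simp)).hasFDerivAt
  have hline : HasDerivAt (fun s : ℝ => ((x, s • b) : E × E)) (0, b) 0 := by
    simpa using (hasDerivAt_const (0 : ℝ) x).prodMk ((hasDerivAt_id (0 : ℝ)).smul_const b)
  have hcomp : HasDerivAt (fun s : ℝ => spray G (x, s • b))
      (fderiv ℝ (spray G) (x, 0) (0, b)) 0 :=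
    HasFDerivAt.comp_hasDerivAt (E := E × E) (l := spray G) 0 (by simpa using h) hline
  have hquad : HasDerivAt (fun s : ℝ => spray G (x, s • b)) (b, 0) 0 := by
    simp only [spray, geodesicAccel_smul]
    simpa using ((hasDerivAt_id (0 : ℝ)).smul_const b).prodMk
      (((hasDerivAt_id (0 : ℝ)).pow 2).smul_const (geodesicAccel G (x, b)))
  exact hcomp.unique hquad

theorem hasFDerivAt_spray_zero (hG : IsMetricOn G U) (hx : x ∈ U) :
    HasFDerivAt (spray G) ((ContinuousLinearMap.inl ℝ E E).comp (ContinuousLinearMap.snd ℝ E E))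
      (x, 0) := by
  convert! ((hG.contDiffAt_spray hx 0).differentiableAt (by simp)).hasFDerivAt using 1
  refine ContinuousLinearMap.ext fun ⟨a, b⟩ => ?_
  have hab : ((a, b) : E × E) = (a, 0) + (0, b) := by simp
  rw [hab, map_add (fderiv ℝ (spray G) (x, 0)), hG.fderiv_spray_zero_left hx,
    hG.fderiv_spray_zero_right hx]
  simp

end IsMetricOn

variable [FiniteDimensional ℝ E]

theorem exists_pos_mul_sq_le {B : E →L[ℝ] E →L[ℝ] ℝ} (hB : ∀ a, a ≠ 0 → 0 < B a a) :
    ∃ m > 0, ∀ a, m * ‖a‖ ^ 2 ≤ B a a := by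
  rcases subsingleton_or_nontrivial E with hE | hE
  · exact ⟨1, one_pos, fun a => by simp [Subsingleton.elim a 0]⟩
  obtain ⟨v, hv, hmin⟩ := (isCompact_sphere (0 : E) 1).exists_isMinOn
    (NormedSpace.sphere_nonempty.2 zero_le_one) (f := fun a => B a a) (by fun_prop)
  refine ⟨B v v, hB v (ne_zero_of_mem_unit_sphere ⟨v, hv⟩), fun a => ?_⟩
  rcases eq_or_ne a 0 with rfl | ha
  · simp
  have ha' : ‖a‖ ≠ 0 := norm_ne_zero_iff.2 ha
  have hle : B v v ≤ B (‖a‖⁻¹ • a) (‖a‖⁻¹ • a) := hmin (by simp [norm_smul, ha'])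
  simp only [map_smul, smul_apply, smul_eq_mul] at hle
  calc B v v * ‖a‖ ^ 2 ≤ (‖a‖⁻¹ * (‖a‖⁻¹ * B a a)) * ‖a‖ ^ 2 := by gcongr
    _ = B a a := by field_simp

theorem IsMetricOn.exists_lower_bound (hG : IsMetricOn G U) (hx : x ∈ U) :
    ∃ m > 0, ∀ᶠ y in 𝓝 x, ∀ a, m * ‖a‖ ^ 2 ≤ G y a a := by
  obtain ⟨m, hm, hmG⟩ := exists_pos_mul_sq_le (hG.pos x hx)
  refine ⟨m / 2, half_pos hm, ?_⟩
  have hcont : ContinuousAt G x := (hG.contDiffAt hx).continuousAt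
  filter_upwards [Metric.continuousAt_iff'.1 hcont (m / 2) (half_pos hm)] with y hy a
  rw [dist_eq_norm] at hy
  have hdiff : |(G y - G x) a a| ≤ m / 2 * ‖a‖ ^ 2 := by
    calc |(G y - G x) a a| ≤ ‖G y - G x‖ * ‖a‖ * ‖a‖ := (G y - G x).le_opNorm₂ a a
      _ ≤ m / 2 * ‖a‖ * ‖a‖ := by gcongr
      _ = m / 2 * ‖a‖ ^ 2 := by ring
  have hlower := (abs_le.1 hdiff).1
  simp only [sub_apply] at hlower
  linarith [hmG a]

end Spray

section LocalFlow

variable {F : Type*} [NormedAddCommGroup F] [NormedSpace ℝ F]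

/-- A family `α` of integral curves of the vector field `f` on the time interval `[0, ε]`, indexed
by their initial values in `s` and Lipschitz in the initial value. -/
structure IsLipschitzFlow (f : F → F) (s : Set F) (ε L : ℝ) (α : F → ℝ → F) : Prop where
  map_zero : ∀ z ∈ s, α z 0 = z
  hasDerivAt : ∀ z ∈ s, ∀ t ∈ Icc 0 ε, HasDerivAt (α z) (f (α z t)) t
  norm_sub_le : ∀ z ∈ s, ∀ z' ∈ s, ∀ t ∈ Icc 0 ε, ‖α z t - α z' t‖ ≤ L * ‖z - z'‖

theorem eventuallyEq_const_of_rest_point {f : F → F} {z₀ : F} (hf : ContDiffAt ℝ 1 f z₀)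
    (hf₀ : f z₀ = 0) {c : ℝ → F} (hc₀ : c 0 = z₀) (hc : ∀ᶠ t in 𝓝 0, HasDerivAt c (f (c t)) t) :
    c =ᶠ[𝓝 0] fun _ => z₀ := by
  obtain ⟨K, s, hs, hK⟩ := hf.exists_lipschitzOnWith
  have hcs : ∀ᶠ t in 𝓝 0, c t ∈ s := hc.self_of_nhds.continuousAt (by rwa [hc₀])
  refine ODE_solution_unique_of_eventually (v := fun _ => f) (s := fun _ => s) (K := K)
    (.of_forall fun _ => hK) (hc.and hcs) (.of_forall fun t => ⟨?_, mem_of_mem_nhds hs⟩) hc₀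
  rw [hf₀]
  exact hasDerivAt_const t z₀

theorem exists_isLipschitzFlow [CompleteSpace F] {f : F → F} {z₀ : F} (hf : ContDiffAt ℝ 1 f z₀)
    (hf₀ : f z₀ = 0) :
    ∃ ε > 0, ∃ r > 0, ∃ L > 0, ∃ α, IsLipschitzFlow f (Metric.closedBall z₀ r) ε L α ∧
      ∀ t ∈ Icc 0 ε, α z₀ t = z₀ := by
  obtain ⟨ε₀, hε₀, _, r, _, _, hr, hpl⟩ := IsPicardLindelof.of_contDiffAt_one hf
  obtain ⟨α, hα, L, hL⟩ := (hpl 0).exists_forall_mem_closedBall_eq_hasDerivWithinAt_lipschitzOnWith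
  simp only [zero_sub, zero_add] at hα hL
  have hα' : ∀ z ∈ Metric.closedBall z₀ r, ∀ t ∈ Ioo (-ε₀) ε₀, HasDerivAt (α z) (f (α z t)) t :=
    fun z hz t ht => ((hα z hz).2 t (Ioo_subset_Icc_self ht)).hasDerivAt (Icc_mem_nhds ht.1 ht.2)
  have hz₀ : z₀ ∈ Metric.closedBall z₀ r := Metric.mem_closedBall_self r.2
  obtain ⟨ε₁, hε₁, hrest⟩ := Metric.eventually_nhds_iff.1 <|
    eventuallyEq_const_of_rest_point hf hf₀ (hα z₀ hz₀).1 <| Filter.mem_of_superset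
      (Ioo_mem_nhds (neg_lt_zero.2 hε₀) hε₀) (hα' z₀ hz₀)
  obtain ⟨ε, hε, hεlt⟩ := exists_between (lt_min hε₀ hε₁)
  have htime : ∀ t ∈ Icc 0 ε, t ∈ Ioo (-ε₀) ε₀ := fun t ht =>
    ⟨by linarith [ht.1], by linarith [ht.2, hεlt.trans_le (min_le_left _ _)]⟩
  refine ⟨ε, hε, r, hr, L + 1, by positivity, α, ⟨fun z hz => (hα z hz).1,
    fun z hz t ht => hα' z hz t (htime t ht), fun z hz z' hz' t ht => ?_⟩, fun t ht => hrest ?_⟩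
  · calc ‖α z t - α z' t‖ ≤ L * ‖z - z'‖ :=
          (hL t (Ioo_subset_Icc_self (htime t ht))).norm_sub_le hz hz'
      _ ≤ (L + 1) * ‖z - z'‖ := by gcongr; linarith
  · rw [Real.dist_eq, sub_zero, abs_of_nonneg ht.1]
    linarith [ht.2, hεlt.trans_le (min_le_right _ _)]

theorem IsLipschitzFlow.exists_forall_mem {f : F → F} {s : Set F} {ε L : ℝ} {α : F → ℝ → F}
    (hα : IsLipschitzFlow f s ε L α) (hL : 0 < L) {z₀ : F} (hs : s ∈ 𝓝 z₀)
    (hrest : ∀ t ∈ Icc 0 ε, α z₀ t = z₀) {N : Set F} (hN : N ∈ 𝓝 z₀) :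
    ∃ ρ > 0, ∀ z ∈ Metric.ball z₀ ρ, z ∈ s ∧ ∀ t ∈ Icc 0 ε, α z t ∈ N := by
  obtain ⟨δ, hδ, hball⟩ := Metric.mem_nhds_iff.1 hN
  obtain ⟨ρ, hρ, hρs⟩ := Metric.mem_nhds_iff.1 hs
  refine ⟨min ρ (δ / L), by positivity, fun z hz => ?_⟩
  have hzs : z ∈ s := hρs (Metric.ball_subset_ball (min_le_left _ _) hz)
  refine ⟨hzs, fun t ht => hball ?_⟩
  have hle := hα.norm_sub_le z hzs z₀ (mem_of_mem_nhds hs) t ht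
  rw [hrest t ht] at hle
  rw [mem_ball_iff_norm] at hz ⊢
  exact hle.trans_lt ((lt_div_iff₀' hL).1 (hz.trans_le (min_le_right _ _)))

theorem norm_sub_sub_smul_le_of_norm_deriv_le {p q a : ℝ → F} {C ε : ℝ} (hε : 0 ≤ ε)
    (hp : ∀ t ∈ Icc 0 ε, HasDerivAt p (q t) t) (hq : ∀ t ∈ Icc 0 ε, HasDerivAt q (a t) t)
    (ha : ∀ t ∈ Icc 0 ε, ‖a t‖ ≤ C) : ‖p ε - p 0 - ε • q 0‖ ≤ C * ε ^ 2 := by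
  have hC : 0 ≤ C := (norm_nonneg _).trans (ha 0 ⟨le_rfl, hε⟩)
  have hq' : ∀ t ∈ Icc 0 ε, ‖q t - q 0‖ ≤ C * ε := fun t ht =>
    calc ‖q t - q 0‖ ≤ C * (t - 0) := norm_image_sub_le_of_norm_deriv_le_segment'
          (fun t ht => (hq t ht).hasDerivWithinAt) (fun t ht => ha t (Ico_subset_Icc_self ht)) t ht
      _ ≤ C * ε := by gcongr; linarith [ht.2]
  have hp' : ∀ t ∈ Icc 0 ε, HasDerivAt (fun t => p t - t • q 0) (q t - q 0) t := fun t ht => by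
    simpa using (hp t ht).fun_sub ((hasDerivAt_id t).smul_const (q 0))
  have hle := norm_image_sub_le_of_norm_deriv_le_segment'
    (fun t ht => (hp' t ht).hasDerivWithinAt) (fun t ht => hq' t (Ico_subset_Icc_self ht)) ε
    ⟨hε, le_rfl⟩
  calc ‖p ε - p 0 - ε • q 0‖ = ‖p ε - ε • q 0 - (p 0 - (0 : ℝ) • q 0)‖ := by congr 1; module
    _ ≤ C * ε * (ε - 0) := hle
    _ = C * ε ^ 2 := by ring

end LocalFlow

section VelocityFlow

variable {E : Type*} [NormedAddCommGroup E] [NormedSpace ℝ E]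

/-- A family of solutions `Z w` of the second order equation `f` on `[0, ε]` that start at `x₀` with
velocities `w` in the ball of radius `ρ`, stay in the region `B` of phase space, are `L`-Lipschitz
in `w`, and whose position at time `ε` is close to a homothety in `w`: a substitute for the
exponential map at `x₀`. -/
structure IsVelocityFlow (f : E × E → E × E) (x₀ : E) (B : Set (E × E)) (ε ρ L : ℝ)
    (Z : E → ℝ → E × E) : Prop where
  time_pos : 0 < ε
  radius_pos : 0 < ρ
  map_zero : ∀ w ∈ Metric.ball (0 : E) ρ, Z w 0 = (x₀, w)
  position_zero : (Z 0 ε).1 = x₀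
  hasDerivAt : ∀ w ∈ Metric.ball (0 : E) ρ, ∀ t ∈ Icc 0 ε, HasDerivAt (Z w) (f (Z w t)) t
  mem : ∀ w ∈ Metric.ball (0 : E) ρ, ∀ t ∈ Icc 0 ε, Z w t ∈ B
  norm_sub_le : ∀ w ∈ Metric.ball (0 : E) ρ, ∀ v ∈ Metric.ball (0 : E) ρ, ∀ t ∈ Icc 0 ε,
    ‖Z w t - Z v t‖ ≤ L * ‖w - v‖
  position_sub : ∀ w ∈ Metric.ball (0 : E) ρ, ∀ v ∈ Metric.ball (0 : E) ρ,
    ‖(Z w ε).1 - (Z v ε).1 - ε • (w - v)‖ ≤ ε / 2 * ‖w - v‖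

theorem exists_nhds_norm_snd_sub_le {f : E × E → E × E} {x₀ : E} (hf : ContDiffAt ℝ 1 f (x₀, 0))
    (hf' : HasFDerivAt f ((ContinuousLinearMap.inl ℝ E E).comp (ContinuousLinearMap.snd ℝ E E))
      (x₀, 0)) {κ : ℝ} (hκ : 0 < κ) :
    ∃ N ∈ 𝓝 (x₀, (0 : E)), ∀ z ∈ N, ∀ z' ∈ N, ‖(f z).2 - (f z').2‖ ≤ κ * ‖z - z'‖ := by
  have hstrict := hf.hasStrictFDerivAt (by simp)
  rw [hf'.fderiv] at hstrict
  obtain ⟨N, hN, happrox⟩ := hstrict.approximates_deriv_on_nhds (c := ⟨κ, hκ.le⟩)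
    (Or.inr (by exact_mod_cast hκ))
  refine ⟨N, hN, fun z hz z' hz' => ?_⟩
  have hle := (norm_snd_le _).trans (happrox z hz z' hz')
  simpa using! hle

theorem norm_position_sub_le {f : E × E → E × E} (hfst : ∀ z, (f z).1 = z.2) {c c' : ℝ → E × E}
    {C ε : ℝ} (hε : 0 ≤ ε) (hc : ∀ t ∈ Icc 0 ε, HasDerivAt c (f (c t)) t)
    (hc' : ∀ t ∈ Icc 0 ε, HasDerivAt c' (f (c' t)) t) (h₀ : (c 0).1 = (c' 0).1)
    (hC : ∀ t ∈ Icc 0 ε, ‖(f (c t)).2 - (f (c' t)).2‖ ≤ C) :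
    ‖(c ε).1 - (c' ε).1 - ε • ((c 0).2 - (c' 0).2)‖ ≤ C * ε ^ 2 := by
  have hd := fun t ht => (hc t ht).fun_sub (hc' t ht)
  have hp : ∀ t ∈ Icc 0 ε, HasDerivAt (fun t => (c t).1 - (c' t).1) ((c t).2 - (c' t).2) t :=
    fun t ht => by simpa [hfst] using hasDerivAt_fst (hd t ht)
  have hq : ∀ t ∈ Icc 0 ε, HasDerivAt (fun t => (c t).2 - (c' t).2)
      ((f (c t)).2 - (f (c' t)).2) t := fun t ht => hasDerivAt_snd (hd t ht)
  simpa [h₀] using norm_sub_sub_smul_le_of_norm_deriv_le hε hp hq hC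

theorem exists_isVelocityFlow [CompleteSpace E] {f : E × E → E × E} {x₀ : E}
    (hf : ContDiffAt ℝ 1 f (x₀, 0)) (hf₀ : f (x₀, 0) = 0)
    (hf' : HasFDerivAt f ((ContinuousLinearMap.inl ℝ E E).comp (ContinuousLinearMap.snd ℝ E E))
      (x₀, 0)) (hfst : ∀ z, (f z).1 = z.2) {B : Set (E × E)} (hB : B ∈ 𝓝 (x₀, 0)) :
    ∃ ε ρ L Z, IsVelocityFlow f x₀ B ε ρ L Z := by
  obtain ⟨ε, hε, r, hr, L, hL, α, hα, hrest⟩ := exists_isLipschitzFlow hf hf₀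
  obtain ⟨N, hN, hfN⟩ := exists_nhds_norm_snd_sub_le hf hf' (κ := 1 / (2 * L * ε)) (by positivity)
  obtain ⟨ρ, hρ, hmem⟩ := hα.exists_forall_mem hL (Metric.closedBall_mem_nhds _ hr) hrest
    (Filter.inter_mem hB hN)
  have hball : ∀ w ∈ Metric.ball (0 : E) ρ, (x₀, w) ∈ Metric.ball (x₀, (0 : E)) ρ := fun w hw => by
    simpa [Prod.dist_eq, hρ] using hw
  have hs := fun w hw => (hmem _ (hball w hw)).1
  have hlip : ∀ w ∈ Metric.ball (0 : E) ρ, ∀ v ∈ Metric.ball (0 : E) ρ, ∀ t ∈ Icc 0 ε,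
      ‖α (x₀, w) t - α (x₀, v) t‖ ≤ L * ‖w - v‖ := fun w hw v hv t ht => by
    simpa [Prod.norm_def] using hα.norm_sub_le _ (hs w hw) _ (hs v hv) t ht
  refine ⟨ε, ρ, L, fun w => α (x₀, w), hε, hρ, fun w hw => hα.map_zero _ (hs w hw), ?_,
    fun w hw => hα.hasDerivAt _ (hs w hw), fun w hw t ht => ((hmem _ (hball w hw)).2 t ht).1,
    hlip, fun w hw v hv => ?_⟩
  · rw [hrest ε ⟨hε.le, le_rfl⟩]
  have hC : ∀ t ∈ Icc 0 ε, ‖(f (α (x₀, w) t)).2 - (f (α (x₀, v) t)).2‖ ≤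
      1 / (2 * L * ε) * (L * ‖w - v‖) := fun t ht =>
    (hfN _ ((hmem _ (hball w hw)).2 t ht).2 _ ((hmem _ (hball v hv)).2 t ht).2).trans
      (by gcongr; exact hlip w hw v hv t ht)
  have hpos := norm_position_sub_le hfst hε.le (hα.hasDerivAt _ (hs w hw))
    (hα.hasDerivAt _ (hs v hv)) (by rw [hα.map_zero _ (hs w hw), hα.map_zero _ (hs v hv)]) hC
  rw [hα.map_zero _ (hs w hw), hα.map_zero _ (hs v hv)] at hpos
  refine hpos.trans_eq ?_
  field_simp

end VelocityFlow

section Energy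

variable {E : Type*} [NormedAddCommGroup E] [NormedSpace ℝ E]
  {G : E → E →L[ℝ] E →L[ℝ] ℝ} {U : Set E}

/-- Twice the kinetic energy of a metric, as a function on phase space. -/
def energy (G : E → E →L[ℝ] E →L[ℝ] ℝ) (z : E × E) : ℝ := G z.1 z.2 z.2

theorem energy_smul (G : E → E →L[ℝ] E →L[ℝ] ℝ) (s : ℝ) (x u : E) :
    energy G (x, s • u) = s ^ 2 * energy G (x, u) := by
  simp only [energy, map_smul, smul_apply, smul_eq_mul]
  ring

namespace IsMetricOn

theorem contDiffAt_energy (hG : IsMetricOn G U) {z : E × E} (hz : z.1 ∈ U) :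
    ContDiffAt ℝ ∞ (energy G) z := by
  have hG₁ : ContDiffAt ℝ ∞ (fun z : E × E => G z.1) z := (hG.contDiffAt hz).comp z contDiffAt_fst
  exact (hG₁.clm_apply contDiffAt_snd).clm_apply contDiffAt_snd

theorem differentiableAt_energy (hG : IsMetricOn G U) {z : E × E} (hz : z.1 ∈ U) :
    DifferentiableAt ℝ (energy G) z :=
  (hG.contDiffAt_energy hz).differentiableAt (by simp)

theorem fderiv_energy (hG : IsMetricOn G U) {z : E × E} (hz : z.1 ∈ U) (ζ : E × E) :
    fderiv ℝ (energy G) z ζ = fderiv ℝ G z.1 ζ.1 z.2 z.2 + 2 * G z.1 z.2 ζ.2 := by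
  have hG₁ : HasFDerivAt (fun z : E × E => G z.1)
      ((fderiv ℝ G z.1).comp (ContinuousLinearMap.fst ℝ E E)) z :=
    (hG.hasFDerivAt hz).comp z hasFDerivAt_fst
  have henergy : HasFDerivAt (energy G) _ z :=
    (hG₁.clm_apply hasFDerivAt_snd).clm_apply hasFDerivAt_snd
  rw [henergy.fderiv]
  simp only [add_apply, ContinuousLinearMap.comp_apply,
    ContinuousLinearMap.flip_apply, ContinuousLinearMap.coe_fst', ContinuousLinearMap.coe_snd']
  rw [hG.symm _ ζ.2 z.2]
  ring

variable [FiniteDimensional ℝ E]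

theorem fderiv_energy_spray (hG : IsMetricOn G U) {z : E × E} (hz : z.1 ∈ U) :
    fderiv ℝ (energy G) z (spray G z) = 0 := by
  rw [hG.fderiv_energy hz, hG.symm]
  simp only [spray]
  rw [hG.apply_geodesicAccel hz, hG.koszul_self_apply hz]
  ring

theorem energy_eq_of_hasDerivAt (hG : IsMetricOn G U) {z : ℝ → E × E} {ε : ℝ}
    (hz : ∀ t ∈ Icc 0 ε, (z t).1 ∈ U) (hzd : ∀ t ∈ Icc 0 ε, HasDerivAt z (spray G (z t)) t)
    {t : ℝ} (ht : t ∈ Icc 0 ε) : energy G (z t) = energy G (z 0) := by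
  have hd : ∀ t ∈ Icc 0 ε, HasDerivAt (fun t => energy G (z t)) 0 t := fun t ht =>
    hG.fderiv_energy_spray (hz t ht) ▸
      (hG.differentiableAt_energy (hz t ht)).hasFDerivAt.comp_hasDerivAt t (hzd t ht)
  exact constant_of_has_deriv_right_zero (f := fun t => energy G (z t))
    (fun t ht => (hd t ht).continuousAt.continuousWithinAt)
    (fun t ht => (hd t ⟨ht.1, ht.2.le⟩).hasDerivWithinAt) t ht

/-- The integrand of the first variation formula: along a geodesic, the derivative of the momentum
paired with a variation field `η` is half of the derivative of the energy in the direction `η`. -/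
theorem hasDerivAt_momentum (hG : IsMetricOn G U) {z η : ℝ → E × E} {η' : E} {t : ℝ}
    (hz : (z t).1 ∈ U) (hzd : HasDerivAt z (spray G (z t)) t)
    (hη : HasDerivAt η ((η t).2, η') t) :
    HasDerivAt (fun s => G (z s).1 (z s).2 (η s).1) (fderiv ℝ (energy G) (z t) (η t) / 2) t := by
  have hpair : HasDerivAt (fun s => G (z s).1 (z s).2 (η s).1) _ t :=
    (hasDerivAt_clm_comp_apply (hG.hasFDerivAt hz) (hasDerivAt_fst hzd)
      (hasDerivAt_snd hzd)).clm_apply (hasDerivAt_fst hη)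
  convert! hpair using 1
  simp only [spray]
  rw [hG.fderiv_energy hz, add_apply, hG.apply_geodesicAccel hz, hG.koszul_self_apply hz]
  ring

end IsMetricOn

theorem abs_sub_sub_fderiv_le {F : Type*} [NormedAddCommGroup F] [NormedSpace ℝ F] {f : F → ℝ}
    {s : Set F} {K : NNReal} (hs : Convex ℝ s) (hf : ∀ x ∈ s, DifferentiableAt ℝ f x)
    (hK : LipschitzOnWith K (fderiv ℝ f) s) {x y : F} (hx : x ∈ s) (hy : y ∈ s) :
    |f y - f x - fderiv ℝ f x (y - x)| ≤ K * ‖y - x‖ ^ 2 := by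
  have hseg := hs.segment_subset hx hy
  have hle := (convex_segment (𝕜 := ℝ) x y).norm_image_sub_le_of_norm_hasFDerivWithin_le'
    (f := f) (f' := fderiv ℝ f) (φ := fderiv ℝ f x) (C := K * ‖y - x‖)
    (fun z hz => (hf z (hseg hz)).hasFDerivAt.hasFDerivWithinAt)
    (fun z hz => (hK.norm_sub_le (hseg hz) hx).trans (by
      gcongr
      exact norm_sub_le_of_mem_segment hz)) (left_mem_segment ℝ x y) (right_mem_segment ℝ x y)
  rwa [Real.norm_eq_abs, mul_assoc, ← sq] at hle

variable [FiniteDimensional ℝ E]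

theorem IsMetricOn.abs_first_variation_le (hG : IsMetricOn G U) {z ζ : ℝ → E × E} {ε C : ℝ}
    {K : NNReal} {s : Set (E × E)} (hε : 0 ≤ ε) (hsU : ∀ z ∈ s, z.1 ∈ U) (hs : Convex ℝ s)
    (hK : LipschitzOnWith K (fderiv ℝ (energy G)) s)
    (hz : ∀ t ∈ Icc 0 ε, z t ∈ s) (hzd : ∀ t ∈ Icc 0 ε, HasDerivAt z (spray G (z t)) t)
    (hζ : ∀ t ∈ Icc 0 ε, ζ t ∈ s) (hζd : ∀ t ∈ Icc 0 ε, HasDerivAt ζ (spray G (ζ t)) t)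
    (h₀ : (z 0).1 = (ζ 0).1) (hC : ∀ t ∈ Icc 0 ε, ‖ζ t - z t‖ ≤ C) :
    |2 * G (z ε).1 (z ε).2 ((ζ ε).1 - (z ε).1) - ε * (energy G (ζ 0) - energy G (z 0))| ≤
      K * C ^ 2 * ε := by
  set Δ := energy G (ζ 0) - energy G (z 0)
  set β : ℝ → ℝ := fun t => G (z t).1 (z t).2 (ζ t - z t).1
  have hβ : ∀ t ∈ Icc 0 ε, HasDerivAt β (fderiv ℝ (energy G) (z t) (ζ t - z t) / 2) t :=
    fun t ht => hG.hasDerivAt_momentum (hsU _ (hz t ht)) (hzd t ht)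
      (η := fun s => ζ s - z s) (η' := (spray G (ζ t) - spray G (z t)).2)
      ((hζd t ht).sub (hzd t ht))
  have hd : ∀ t ∈ Icc 0 ε, HasDerivAt (fun t => 2 * β t - t * Δ)
      (fderiv ℝ (energy G) (z t) (ζ t - z t) - Δ) t := fun t ht => by
    convert! ((hβ t ht).const_mul 2).sub ((hasDerivAt_id t).mul_const Δ) using 1
    ring
  have hbound : ∀ t ∈ Icc 0 ε, ‖fderiv ℝ (energy G) (z t) (ζ t - z t) - Δ‖ ≤ K * C ^ 2 := by
    intro t ht
    have hΔ : Δ = energy G (ζ t) - energy G (z t) := by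
      rw [hG.energy_eq_of_hasDerivAt (fun t ht => hsU _ (hz t ht)) hzd ht,
        hG.energy_eq_of_hasDerivAt (fun t ht => hsU _ (hζ t ht)) hζd ht]
    rw [hΔ, Real.norm_eq_abs, abs_sub_comm]
    exact (abs_sub_sub_fderiv_le hs (fun x hx => hG.differentiableAt_energy (hsU x hx)) hK
      (hz t ht) (hζ t ht)).trans (by gcongr; exact hC t ht)
  have hle := norm_image_sub_le_of_norm_deriv_le_segment' (a := 0) (b := ε)
    (fun t ht => (hd t ht).hasDerivWithinAt) (fun t ht => hbound t ⟨ht.1, ht.2.le⟩) ε ⟨hε, le_rfl⟩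
  have hβ₀ : β 0 = 0 := by simp [β, h₀]
  simp only [hβ₀, mul_zero, zero_mul, sub_zero] at hle
  exact hle

end Energy

section LocalLog

variable {E : Type*} [NormedAddCommGroup E] [NormedSpace ℝ E]
  {G : E → E →L[ℝ] E →L[ℝ] ℝ} {U : Set E} {x₀ : E}

/-- A local inverse `R` of the exponential map at `x₀` of the metric `G`: the function
`y ↦ G x₀ (R y) (R y)`, a candidate for the square of the distance to `x₀`, satisfies the eikonal
inequality, and geodesics that start at `x₀` in the direction `R y` reach `y`. -/
structure IsLocalLog (G : E → E →L[ℝ] E →L[ℝ] ℝ) (x₀ : E) (r : ℝ) (R : E → E) : Prop where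
  radius_pos : 0 < r
  map_self : R x₀ = 0
  eq_of_map_eq_zero : ∀ y ∈ Metric.ball x₀ r, R y = 0 → y = x₀
  eikonal : ∀ y ∈ Metric.ball x₀ r, ∃ F' : E →L[ℝ] ℝ,
    HasFDerivAt (fun y => G x₀ (R y) (R y)) F' y ∧
      ∀ h, (F' h) ^ 2 ≤ 4 * G x₀ (R y) (R y) * G y h h
  reaches : ∀ y ∈ Metric.ball x₀ r, ∀ ℓ > 0, ∀ z : ℝ → E × E, z 0 = (x₀, ℓ⁻¹ • R y) →
    (∀ t ∈ Icc 0 ℓ, (z t).1 ∈ Metric.ball x₀ r ∧ HasDerivAt z (spray G (z t)) t) → (z ℓ).1 = y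

namespace IsVelocityFlow

variable {f : E × E → E × E} {B : Set (E × E)} {ε ρ L : ℝ} {Z : E → ℝ → E × E}

theorem norm_sub_le_position (hZ : IsVelocityFlow f x₀ B ε ρ L Z) {w v : E}
    (hw : w ∈ Metric.ball 0 ρ) (hv : v ∈ Metric.ball 0 ρ) :
    ‖w - v‖ ≤ 2 / ε * ‖(Z w ε).1 - (Z v ε).1‖ := by
  have hε := hZ.time_pos
  have hle : ‖ε • (w - v)‖ ≤ ‖(Z w ε).1 - (Z v ε).1‖ +
      ‖(Z w ε).1 - (Z v ε).1 - ε • (w - v)‖ := by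
    rw [norm_sub_rev ((Z w ε).1 - (Z v ε).1)]
    exact norm_le_insert' _ _
  rw [norm_smul, Real.norm_of_nonneg hε.le] at hle
  have hhalf : ε / 2 * ‖w - v‖ ≤ ‖(Z w ε).1 - (Z v ε).1‖ := by
    linarith [hZ.position_sub w hw v hv]
  calc ‖w - v‖ = 2 / ε * (ε / 2 * ‖w - v‖) := by field_simp
    _ ≤ 2 / ε * ‖(Z w ε).1 - (Z v ε).1‖ := by gcongr

theorem image_ball_mem_nhds [CompleteSpace E] (hZ : IsVelocityFlow f x₀ B ε ρ L Z) :
    (fun w => (Z w ε).1) '' Metric.ball 0 ρ ∈ 𝓝 x₀ := by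
  have hε := hZ.time_pos
  have happrox : ApproximatesLinearOn (fun w => (Z w ε).1) (ε • ContinuousLinearMap.id ℝ E)
      (Metric.ball 0 ρ) (ε / 2).toNNReal := fun w hw v hv => by
    rw [Real.coe_toNNReal _ (by positivity)]
    exact hZ.position_sub w hw v hv
  let R : (ε • ContinuousLinearMap.id ℝ E).NonlinearRightInverse :=
    { toFun := fun y => ε⁻¹ • y
      nnnorm := ε.toNNReal⁻¹
      bound' := fun y => by simp [norm_smul, abs_of_pos hε, hε.le]
      right_inv' := fun y => by simp [hε.ne'] }
  have himage := happrox.image_mem_nhds R (Metric.ball_mem_nhds 0 hZ.radius_pos) (Or.inr (by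
    simp only [R, inv_inv]
    exact (Real.toNNReal_lt_toNNReal_iff hε).2 (by linarith)))
  rwa [hZ.position_zero] at himage

theorem exists_initialVelocity [CompleteSpace E] (hZ : IsVelocityFlow f x₀ B ε ρ L Z) :
    ∃ W : E → E, W x₀ = 0 ∧
      ∀ᶠ y in 𝓝 x₀, W y ∈ Metric.ball 0 ρ ∧ (Z (W y) ε).1 = y := by
  set X : E → E := fun w => (Z w ε).1
  set W : E → E := Function.invFunOn X (Metric.ball 0 ρ)
  have hW : ∀ y ∈ X '' Metric.ball 0 ρ, W y ∈ Metric.ball 0 ρ ∧ X (W y) = y := fun y hy =>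
    ⟨Function.invFunOn_mem hy, Function.invFunOn_eq hy⟩
  refine ⟨W, ?_, Filter.mem_of_superset hZ.image_ball_mem_nhds hW⟩
  obtain ⟨hmem, hXW⟩ := hW x₀ (mem_of_mem_nhds hZ.image_ball_mem_nhds)
  have hle := hZ.norm_sub_le_position hmem (Metric.mem_ball_self hZ.radius_pos)
  rw [hZ.position_zero, show (Z (W x₀) ε).1 = x₀ from hXW] at hle
  simpa using hle

theorem eq_of_hasDerivAt (hZ : IsVelocityFlow f x₀ B ε ρ L Z) {K : NNReal}
    (hK : LipschitzOnWith K f B) {w : E} (hw : w ∈ Metric.ball 0 ρ) {ζ : ℝ → E × E}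
    (hζ₀ : ζ 0 = (x₀, w)) (hζd : ∀ t ∈ Icc 0 ε, HasDerivAt ζ (f (ζ t)) t)
    (hζ : ∀ t ∈ Icc 0 ε, ζ t ∈ B) : ζ ε = Z w ε :=
  ODE_solution_unique_of_mem_Icc_right (v := fun _ => f) (s := fun _ => B) (fun _ _ => hK)
    (fun t ht => (hζd t ht).continuousAt.continuousWithinAt)
    (fun t ht => (hζd t (Ico_subset_Icc_self ht)).hasDerivWithinAt)
    (fun t ht => hζ t (Ico_subset_Icc_self ht))
    (fun t ht => (hZ.hasDerivAt w hw t ht).continuousAt.continuousWithinAt)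
    (fun t ht => (hZ.hasDerivAt w hw t (Ico_subset_Icc_self ht)).hasDerivWithinAt)
    (fun t ht => hZ.mem w hw t (Ico_subset_Icc_self ht)) (by rw [hζ₀, hZ.map_zero w hw])
    ⟨hZ.time_pos.le, le_rfl⟩

variable [FiniteDimensional ℝ E]

theorem energy_eq (hZ : IsVelocityFlow (spray G) x₀ B ε ρ L Z) (hG : IsMetricOn G U)
    (hB : ∀ z ∈ B, z.1 ∈ U) {w : E} (hw : w ∈ Metric.ball 0 ρ) {t : ℝ} (ht : t ∈ Icc 0 ε) :
    energy G (Z w t) = G x₀ w w := by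
  rw [hG.energy_eq_of_hasDerivAt (fun t ht => hB _ (hZ.mem w hw t ht)) (hZ.hasDerivAt w hw) ht,
    hZ.map_zero w hw, energy]

theorem abs_sub_metric_le (hZ : IsVelocityFlow (spray G) x₀ B ε ρ L Z) (hG : IsMetricOn G U)
    (hB : ∀ z ∈ B, z.1 ∈ U) (hconv : Convex ℝ B) {K : NNReal}
    (hK : LipschitzOnWith K (fderiv ℝ (energy G)) B) {w v : E} (hw : w ∈ Metric.ball 0 ρ)
    (hv : v ∈ Metric.ball 0 ρ) :
    |2 * G (Z v ε).1 (Z v ε).2 ((Z w ε).1 - (Z v ε).1) - ε * (G x₀ w w - G x₀ v v)| ≤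
      K * (L * ‖w - v‖) ^ 2 * ε := by
  have hvar := hG.abs_first_variation_le hZ.time_pos.le hB hconv hK (hZ.mem v hv)
    (hZ.hasDerivAt v hv) (hZ.mem w hw) (hZ.hasDerivAt w hw)
    (by rw [hZ.map_zero v hv, hZ.map_zero w hw]) (hZ.norm_sub_le w hw v hv)
  simpa only [hZ.map_zero v hv, hZ.map_zero w hw, energy] using hvar

theorem hasFDerivAt_metric_initialVelocity (hZ : IsVelocityFlow (spray G) x₀ B ε ρ L Z)
    (hG : IsMetricOn G U) (hB : ∀ z ∈ B, z.1 ∈ U) (hconv : Convex ℝ B) {K : NNReal}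
    (hK : LipschitzOnWith K (fderiv ℝ (energy G)) B) {W : E → E} {y : E}
    (hW : ∀ᶠ y' in 𝓝 y, W y' ∈ Metric.ball 0 ρ ∧ (Z (W y') ε).1 = y') :
    HasFDerivAt (fun y => G x₀ (W y) (W y)) ((2 / ε) • G y (Z (W y) ε).2) y := by
  have hε := hZ.time_pos
  obtain ⟨hv, hXv⟩ := hW.self_of_nhds
  rw [hasFDerivAt_iff_isLittleO]
  refine (Asymptotics.IsBigO.of_bound (K * (|L| * (2 / ε)) ^ 2) ?_).trans_isLittleO
    (Asymptotics.isLittleO_pow_sub_sub y one_lt_two)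
  filter_upwards [hW] with y' hy'
  obtain ⟨hw, hXw⟩ := hy'
  have hvar := hZ.abs_sub_metric_le hG hB hconv hK hw hv
  have hanti := hZ.norm_sub_le_position hw hv
  rw [hXw, hXv] at hvar hanti
  set w := W y'
  set v := W y
  have hscale : G x₀ w w - G x₀ v v - ((2 / ε) • G y (Z v ε).2) (y' - y) =
      -(2 * G y (Z v ε).2 (y' - y) - ε * (G x₀ w w - G x₀ v v)) / ε := by
    simp only [smul_apply, smul_eq_mul]
    field_simp
    ring
  rw [hscale, norm_div, norm_neg, Real.norm_of_nonneg hε.le, Real.norm_eq_abs, norm_pow,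
    norm_norm, div_le_iff₀ hε]
  calc |2 * G y (Z v ε).2 (y' - y) - ε * (G x₀ w w - G x₀ v v)|
      ≤ K * (|L| * ‖w - v‖) ^ 2 * ε := by rwa [mul_pow |L|, sq_abs, ← mul_pow]
    _ ≤ K * (|L| * (2 / ε * ‖y' - y‖)) ^ 2 * ε := by gcongr
    _ = K * (|L| * (2 / ε)) ^ 2 * ‖y' - y‖ ^ 2 * ε := by ring

theorem sq_apply_velocity_le (hZ : IsVelocityFlow (spray G) x₀ B ε ρ L Z) (hG : IsMetricOn G U)
    (hB : ∀ z ∈ B, z.1 ∈ U) {w : E} (hw : w ∈ Metric.ball 0 ρ) (h : E) :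
    (G (Z w ε).1 (Z w ε).2 h) ^ 2 ≤ G x₀ w w * G (Z w ε).1 h h := by
  have hεI : ε ∈ Icc 0 ε := ⟨hZ.time_pos.le, le_rfl⟩
  rw [← hZ.energy_eq hG hB hw hεI]
  exact hG.cauchySchwarz (hB _ (hZ.mem w hw ε hεI)) _ h

/-- Conservation of energy keeps the rescaled geodesic in the region of phase space where solutions
are unique. -/
theorem position_eq_of_hasDerivAt {r₁ r m : ℝ}
    (hZ : IsVelocityFlow (spray G) x₀ (Metric.ball (x₀, 0) r₁) ε ρ L Z) (hG : IsMetricOn G U)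
    {K : NNReal} (hK : LipschitzOnWith K (spray G) (Metric.ball (x₀, 0) r₁)) (hm : 0 < m)
    (hr : ∀ y ∈ Metric.ball x₀ r, y ∈ U ∧ y ∈ Metric.ball x₀ r₁ ∧ ∀ a, m * ‖a‖ ^ 2 ≤ G y a a)
    (hr₁ : 0 < r₁) {w : E} (hw : w ∈ Metric.ball 0 ρ) (hwm : G x₀ w w < m * r₁ ^ 2) {ℓ : ℝ}
    (hℓ : 0 < ℓ) {z : ℝ → E × E} (hz₀ : z 0 = (x₀, ℓ⁻¹ • ε • w))
    (hz : ∀ t ∈ Icc 0 ℓ, (z t).1 ∈ Metric.ball x₀ r ∧ HasDerivAt z (spray G (z t)) t) :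
    (z ℓ).1 = (Z w ε).1 := by
  have hε := hZ.time_pos
  have hkε : ℓ / ε * ε = ℓ := div_mul_cancel₀ ℓ hε.ne'
  set k := ℓ / ε
  have hmemI : ∀ t ∈ Icc 0 ε, k * t ∈ Icc 0 ℓ := fun t ht =>
    ⟨mul_nonneg (by positivity) ht.1, hkε ▸ mul_le_mul_of_nonneg_left ht.2 (by positivity)⟩
  set ζ : ℝ → E × E := fun t => ((z (k * t)).1, k • (z (k * t)).2)
  have hζ₀ : ζ 0 = (x₀, w) := by
    simp only [ζ, mul_zero, hz₀, smul_smul]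
    rw [← hkε, mul_inv, mul_assoc, inv_mul_cancel₀ hε.ne', mul_one, mul_inv_cancel₀, one_smul]
    exact div_ne_zero hℓ.ne' hε.ne'
  have hζd : ∀ t ∈ Icc 0 ε, HasDerivAt ζ (spray G (ζ t)) t := fun t ht =>
    hasDerivAt_rescale (hz _ (hmemI t ht)).2
  have hζr : ∀ t ∈ Icc 0 ε, (ζ t).1 ∈ Metric.ball x₀ r := fun t ht => (hz _ (hmemI t ht)).1
  have hζ : ∀ t ∈ Icc 0 ε, ζ t ∈ Metric.ball (x₀, 0) r₁ := fun t ht => by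
    have henergy : energy G (ζ t) = G x₀ w w := by
      rw [hG.energy_eq_of_hasDerivAt (fun t ht => (hr _ (hζr t ht)).1) hζd ht, hζ₀, energy]
    rw [← ball_prod_same]
    refine ⟨(hr _ (hζr t ht)).2.1, mem_ball_zero_iff.2 (lt_of_pow_lt_pow_left₀ 2 hr₁.le ?_)⟩
    exact lt_of_mul_lt_mul_left
      (((hr _ (hζr t ht)).2.2 (ζ t).2).trans_lt (henergy.trans_lt hwm)) hm.le
  rw [← hZ.eq_of_hasDerivAt hK hw hζ₀ hζd hζ]
  simp only [ζ, hkε]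

end IsVelocityFlow

theorem IsMetricOn.exists_lipschitz_ball [FiniteDimensional ℝ E] (hG : IsMetricOn G U)
    (hx₀ : x₀ ∈ U) :
    ∃ r₁ > 0, (∀ z ∈ Metric.ball (x₀, (0 : E)) r₁, z.1 ∈ U) ∧
      (∃ K, LipschitzOnWith K (fderiv ℝ (energy G)) (Metric.ball (x₀, 0) r₁)) ∧
      ∃ K, LipschitzOnWith K (spray G) (Metric.ball (x₀, 0) r₁) := by
  obtain ⟨K, s, hs, hK⟩ := ((hG.contDiffAt_energy (z := (x₀, (0 : E))) hx₀).fderiv_right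
    (m := 1) (by norm_cast)).exists_lipschitzOnWith
  obtain ⟨K', s', hs', hK'⟩ := (hG.contDiffAt_spray hx₀ 0).exists_lipschitzOnWith
  have hU : U ×ˢ univ ∈ 𝓝 (x₀, (0 : E)) := (hG.isOpen.prod isOpen_univ).mem_nhds ⟨hx₀, trivial⟩
  obtain ⟨r₁, hr₁, hball⟩ := Metric.mem_nhds_iff.1 (Filter.inter_mem (Filter.inter_mem hs hs') hU)
  exact ⟨r₁, hr₁, fun z hz => (hball hz).2.1, ⟨K, hK.mono fun z hz => (hball hz).1.1⟩,
    K', hK'.mono fun z hz => (hball hz).1.2⟩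

theorem IsMetricOn.exists_isLocalLog [FiniteDimensional ℝ E] (hG : IsMetricOn G U)
    (hx₀ : x₀ ∈ U) : ∃ r R, Metric.ball x₀ r ⊆ U ∧ IsLocalLog G x₀ r R := by
  obtain ⟨m, hm, hmG⟩ := hG.exists_lower_bound hx₀
  obtain ⟨r₁, hr₁, hBU, ⟨K, hK⟩, K', hK'⟩ := hG.exists_lipschitz_ball hx₀
  obtain ⟨ε, ρ, L, Z, hZ⟩ := exists_isVelocityFlow (hG.contDiffAt_spray hx₀ 0) (spray_zero x₀)
    (hG.hasFDerivAt_spray_zero hx₀) (fun _ => rfl) (Metric.ball_mem_nhds (x₀, (0 : E)) hr₁)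
  obtain ⟨W, hW₀, hW⟩ := hZ.exists_initialVelocity
  have hε := hZ.time_pos
  have hF := fun y hy => hZ.hasFDerivAt_metric_initialVelocity hG hBU (convex_ball _ _) hK (W := W)
    (y := y) hy
  have hsmall : ∀ᶠ y in 𝓝 x₀, G x₀ (W y) (W y) < m * r₁ ^ 2 :=
    (hF x₀ hW).continuousAt.eventually_lt continuousAt_const (by
      simpa only [hW₀, map_zero] using mul_pos hm (pow_pos hr₁ 2))
  obtain ⟨r, hr, hball⟩ := Metric.eventually_nhds_iff_ball.1 <|
    hW.eventually_nhds.and <| hsmall.and <| (hG.isOpen.eventually_mem hx₀).and <|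
      (Metric.isOpen_ball.eventually_mem (Metric.mem_ball_self hr₁)).and hmG
  have hWr : ∀ y ∈ Metric.ball x₀ r, W y ∈ Metric.ball 0 ρ ∧ (Z (W y) ε).1 = y := fun y hy =>
    (hball y hy).1.self_of_nhds
  have hscale : ∀ y, G x₀ (ε • W y) (ε • W y) = ε ^ 2 * G x₀ (W y) (W y) := fun y =>
    energy_smul G ε x₀ (W y)
  refine ⟨r, fun y => ε • W y, fun y hy => (hball y hy).2.2.1, hr, by simp [hW₀],
    fun y hy hy₀ => ?_, fun y hy => ?_, fun y hy ℓ hℓ z hz₀ hz => ?_⟩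
  · rw [← (hWr y hy).2, (smul_eq_zero_iff_right hε.ne').1 hy₀, hZ.position_zero]
  · simp only [hscale]
    refine ⟨_, (hF y (hball y hy).1).const_mul (ε ^ 2), fun h => ?_⟩
    have hCS := hZ.sq_apply_velocity_le hG hBU (hWr y hy).1 h
    rw [(hWr y hy).2] at hCS
    calc ((ε ^ 2 • (2 / ε) • G y (Z (W y) ε).2) h) ^ 2
        = 4 * ε ^ 2 * (G y (Z (W y) ε).2 h) ^ 2 := by
          simp only [smul_apply, smul_eq_mul]
          field_simp
          ring
      _ ≤ 4 * ε ^ 2 * (G x₀ (W y) (W y) * G y h h) := by gcongr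
      _ = 4 * (ε ^ 2 * G x₀ (W y) (W y)) * G y h h := by ring
  · exact (hZ.position_eq_of_hasDerivAt hG hK' hm (fun y hy => (hball y hy).2.2) hr₁ (hWr y hy).1
      (hball y hy).2.1 hℓ hz₀ hz).trans (hWr y hy).2

end LocalLog

section Velocity

variable {n : ℕ} {M : Type*} [TopologicalSpace M] [ChartedSpace (𝔼 n) M] [IsManifold (𝓡 n) ∞ M]
  {γ : ℝ → M}

theorem contMDiff_unitField : ContMDiff 𝓘(ℝ, ℝ) 𝓘(ℝ, ℝ).tangent ∞
    (fun t : ℝ => (⟨t, (1 : ℝ)⟩ : TangentBundle 𝓘(ℝ, ℝ) ℝ)) :=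
  contMDiffOn_univ.1 (contMDiffOn_vectorSpace_iff_contDiffOn.2 contDiffOn_const)

theorem continuous_velocity (hγ : ContMDiff 𝓘(ℝ, ℝ) (𝓡 n) 1 γ) : Continuous (velocity n γ) :=
  have : IsManifold (𝓡 n) 1 M := .of_le (n := ∞) (by decide)
  (hγ.continuous_tangentMap le_rfl).comp contMDiff_unitField.continuous

theorem contMDiff_velocity (hγ : ContMDiff 𝓘(ℝ, ℝ) (𝓡 n) ∞ γ) :
    ContMDiff 𝓘(ℝ, ℝ) (𝓡 n).tangent ∞ (velocity n γ) :=
  (hγ.contMDiff_tangentMap (by decide)).comp contMDiff_unitField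

/-- The chart of `TM` induced by the preferred chart of `M` around `p`: a tangent vector is sent to
the coordinates of its foot point together with its components. -/
def tangentChart (p : M) (V : TangentBundle (𝓡 n) M) : 𝔼 n × 𝔼 n :=
  (extChartAt (𝓡 n) p V.proj, tangentCoord p V)

theorem tangentChart_self (p : M) (X : TangentSpace (𝓡 n) p) :
    tangentChart p ⟨p, X⟩ = (extChartAt (𝓡 n) p p, X) :=
  Prod.ext rfl (tangentCoord_self p X)

theorem tangentCoord_zero (p q : M) : tangentCoord p ⟨q, (0 : TangentSpace (𝓡 n) q)⟩ = 0 :=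
  map_zero (tangentCoordChange (𝓡 n) q p q)

variable [RiemannianBundle (fun x : M => TangentSpace (𝓡 n) x)]

theorem energy_tangentChart {p : M} {V : TangentBundle (𝓡 n) M}
    (hp : V.proj ∈ (chartAt (𝔼 n) p).source) :
    energy (chartMetric n p) (tangentChart p V) = ‖V.2‖ ^ 2 :=
  (norm_sq_eq_chartMetric hp).symm

theorem norm_eq_sqrt_energy (p : M) (X : TangentSpace (𝓡 n) p) :
    ‖X‖ = √(energy (chartMetric n p) (extChartAt (𝓡 n) p p, X)) := by
  have henergy := energy_tangentChart (p := p) (V := ⟨p, X⟩) (mem_chart_source _ p)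
  rw [tangentChart_self] at henergy
  exact (Real.sqrt_sq (norm_nonneg X)).symm.trans (congrArg Real.sqrt henergy.symm)

variable [IsContMDiffRiemannianBundle (𝓡 n) ∞ (𝔼 n) (fun x : M => TangentSpace (𝓡 n) x)]

theorem isMetricOn_chartMetric (p : M) :
    IsMetricOn (chartMetric n p) (extChartAt (𝓡 n) p).target where
  isOpen := isOpen_extChartAt_target p
  contDiffOn := contDiffOn_chartMetric p
  symm := chartMetric_symm p
  pos _ hx _ ha := chartMetric_pos hx ha

theorem continuous_speed (hγ : ContMDiff 𝓘(ℝ, ℝ) (𝓡 n) 1 γ) :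
    Continuous fun t => ‖(velocity n γ t).2‖ := by
  have : IsContinuousRiemannianBundle (𝔼 n) (fun x : M => TangentSpace (𝓡 n) x) := by
    obtain ⟨g, hg, hg'⟩ := IsContMDiffRiemannianBundle.exists_contMDiff (IB := 𝓡 n) (n := ∞)
      (F := 𝔼 n) (E := fun x : M => TangentSpace (𝓡 n) x)
    exact ⟨⟨g, hg.continuous, hg'⟩⟩
  have hinner := Continuous.inner_bundle (F := 𝔼 n) (E := fun x : M => TangentSpace (𝓡 n) x)
    (v := fun t => (velocity n γ t).2) (w := fun t => (velocity n γ t).2)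
    (continuous_velocity hγ) (continuous_velocity hγ)
  simpa only [norm_eq_sqrt_real_inner] using hinner.sqrt

namespace IsGeodesic

theorem hasDerivAt_tangentCoord (hγ : IsGeodesic n γ) {p : M} {t : ℝ}
    (hp : γ t ∈ (chartAt (𝔼 n) p).source) :
    HasDerivAt (fun s => tangentCoord p (velocity n γ s))
      (geodesicAccel (chartMetric n p) (tangentChart p (velocity n γ t))) t := by
  have hV : MDifferentiableAt 𝓘(ℝ, ℝ) (𝓡 n).tangent (velocity n γ) t :=
    (contMDiff_velocity hγ.smooth).mdifferentiable (by decide) t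
  have hu := (differentiableAt_tangentCoord hV hp).hasDerivAt
  have haccel : deriv (fun s => tangentCoord p (velocity n γ s)) t =
      geodesicAccel (chartMetric n p) (tangentChart p (velocity n γ t)) := by
    refine (isMetricOn_chartMetric p).eq_geodesicAccel (extChartAt_mem_target hp) fun w => ?_
    have hK := chartMetric_connectionMap hV hp hu w
    rw [hγ.covDeriv_eq_zero t, tangentCoord_zero, map_zero, zero_apply] at hK
    exact eq_neg_of_add_eq_zero_left hK.symm
  exact haccel ▸ hu

theorem hasDerivAt_tangentChart (hγ : IsGeodesic n γ) {p : M} {t : ℝ}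
    (hp : γ t ∈ (chartAt (𝔼 n) p).source) :
    HasDerivAt (fun s => tangentChart p (velocity n γ s))
      (spray (chartMetric n p) (tangentChart p (velocity n γ t))) t :=
  (hasDerivAt_extChartAt_comp (hγ.smooth.mdifferentiable (by decide) t) hp).prodMk
    (hγ.hasDerivAt_tangentCoord hp)

end IsGeodesic

end Velocity

section ArcLength

variable {n : ℕ} {M : Type*} [TopologicalSpace M] [ChartedSpace (𝔼 n) M]
  [RiemannianBundle (fun x : M => TangentSpace (𝓡 n) x)] {γ : ℝ → M}

variable (n) in
/-- The length of the restriction of a curve to `[a, b]`, as a real number. -/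
def arcLength (γ : ℝ → M) (a b : ℝ) : ℝ := ∫ t in a..b, ‖(velocity n γ t).2‖

theorem arcLength_nonneg (γ : ℝ → M) {a b : ℝ} (hab : a ≤ b) : 0 ≤ arcLength n γ a b :=
  intervalIntegral.integral_nonneg hab fun _ _ => norm_nonneg _

variable [IsManifold (𝓡 n) ∞ M]
  [IsContMDiffRiemannianBundle (𝓡 n) ∞ (𝔼 n) (fun x : M => TangentSpace (𝓡 n) x)]

theorem arcLength_add (hγ : ContMDiff 𝓘(ℝ, ℝ) (𝓡 n) 1 γ) (a b c : ℝ) :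
    arcLength n γ a b + arcLength n γ b c = arcLength n γ a c :=
  intervalIntegral.integral_add_adjacent_intervals ((continuous_speed hγ).intervalIntegrable _ _)
    ((continuous_speed hγ).intervalIntegrable _ _)

theorem pathELength_eq_ofReal_arcLength (hγ : ContMDiff 𝓘(ℝ, ℝ) (𝓡 n) 1 γ) {a b : ℝ}
    (hab : a ≤ b) : pathELength (𝓡 n) γ a b = ENNReal.ofReal (arcLength n γ a b) := by
  have hspeed : Integrable (fun t => ‖(velocity n γ t).2‖) (volume.restrict (Ioc a b)) :=
    (continuous_speed hγ).integrableOn_Ioc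
  rw [arcLength, intervalIntegral.integral_of_le hab, ofReal_integral_eq_lintegral_ofReal hspeed
    (.of_forall fun _ => norm_nonneg _), pathELength_eq_lintegral_mfderiv_Icc,
    restrict_Ioc_eq_restrict_Icc]
  refine lintegral_congr fun t => ?_
  rw [ofReal_norm]
  rfl

end ArcLength

section Distance

variable {n : ℕ} {M : Type*} [MetricSpace M] [ChartedSpace (𝔼 n) M]
  [RiemannianBundle (fun x : M => TangentSpace (𝓡 n) x)] [IsRiemannianManifold (𝓡 n) M]
  {γ : ℝ → M} {p q : M}

theorem dist_le_of_speed_le {a b K : ℝ} (hab : a ≤ b)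
    (hγ : ContMDiffOn 𝓘(ℝ, ℝ) (𝓡 n) 1 γ (Icc a b)) (hK₀ : 0 ≤ K)
    (hK : ∀ t ∈ Ioo a b, ‖(velocity n γ t).2‖ ≤ K) : dist (γ a) (γ b) ≤ K * (b - a) := by
  rw [← ENNReal.ofReal_le_ofReal_iff (mul_nonneg hK₀ (sub_nonneg.2 hab)), ← edist_dist,
    IsRiemannianManifold.out (I := 𝓡 n)]
  refine (riemannianEDist_le_pathELength hγ rfl rfl hab).trans ?_
  rw [pathELength_eq_lintegral_mfderiv_Ioo]
  calc _ ≤ ∫⁻ _ in Ioo a b, ENNReal.ofReal K := by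
        refine setLIntegral_mono measurable_const fun t ht => ?_
        rw [← ofReal_norm]
        exact ENNReal.ofReal_le_ofReal (hK t ht)
    _ = _ := by rw [setLIntegral_const, Real.volume_Ioo, ENNReal.ofReal_mul hK₀]

variable [IsManifold (𝓡 n) ∞ M]

theorem IsGeodesic.dist_le (hγ : IsGeodesic n γ) (s t : ℝ) : dist (γ s) (γ t) ≤ |s - t| := by
  wlog hst : s ≤ t generalizing s t
  · rw [dist_comm, abs_sub_comm]
    exact this t s (not_le.1 hst).le
  rw [abs_sub_comm, abs_of_nonneg (sub_nonneg.2 hst), ← one_mul (t - s)]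
  exact dist_le_of_speed_le hst (hγ.smooth.of_le (by decide)).contMDiffOn zero_le_one
    fun t _ => (hγ.unit_speed t).le

variable [IsContMDiffRiemannianBundle (𝓡 n) ∞ (𝔼 n) (fun x : M => TangentSpace (𝓡 n) x)]

theorem dist_le_arcLength (hγ : ContMDiff 𝓘(ℝ, ℝ) (𝓡 n) 1 γ) {a b : ℝ} (hab : a ≤ b) :
    dist (γ a) (γ b) ≤ arcLength n γ a b := by
  rw [← ENNReal.ofReal_le_ofReal_iff (arcLength_nonneg γ hab), ← edist_dist,
    IsRiemannianManifold.out (I := 𝓡 n), ← pathELength_eq_ofReal_arcLength hγ hab]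
  exact riemannianEDist_le_pathELength hγ.contMDiffOn rfl rfl hab

theorem dist_add_dist_le_arcLength (hγ : ContMDiff 𝓘(ℝ, ℝ) (𝓡 n) 1 γ) {a b t : ℝ}
    (ht : t ∈ Icc a b) : dist (γ a) (γ t) + dist (γ t) (γ b) ≤ arcLength n γ a b :=
  (add_le_add (dist_le_arcLength hγ ht.1) (dist_le_arcLength hγ ht.2)).trans_eq
    (arcLength_add hγ a t b)

theorem exists_arcLength_lt {r : ℝ} (hr : dist p q < r) :
    ∃ γ : ℝ → M, ContMDiff 𝓘(ℝ, ℝ) (𝓡 n) 1 γ ∧ γ 0 = p ∧ γ 1 = q ∧ arcLength n γ 0 1 < r := by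
  have hr₀ : 0 < r := dist_nonneg.trans_lt hr
  have hr' : riemannianEDist (𝓡 n) p q < ENNReal.ofReal r := by
    rw [← IsRiemannianManifold.out (I := 𝓡 n), edist_dist]
    exact (ENNReal.ofReal_lt_ofReal_iff hr₀).2 hr
  obtain ⟨γ, h0, h1, hγ, hlength, -⟩ :=
    exists_lt_locally_constant_of_riemannianEDist_lt hr' zero_lt_one
  rw [pathELength_eq_ofReal_arcLength hγ zero_le_one] at hlength
  exact ⟨γ, hγ, h0, h1, (ENNReal.ofReal_lt_ofReal_iff hr₀).1 hlength⟩

end Distance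

section Eikonal

theorem div_two_mul_sqrt_le {a b c ε : ℝ} (ha : 0 ≤ a) (hc : 0 ≤ c) (hε : 0 < ε)
    (h : b ^ 2 ≤ 4 * c * a ^ 2) : b / (2 * √(c + ε)) ≤ a := by
  have hpos : 0 < c + ε := by positivity
  rw [div_le_iff₀ (by positivity)]
  refine le_of_abs_le (abs_le_of_sq_le_sq ?_ (by positivity))
  calc b ^ 2 ≤ 4 * c * a ^ 2 := h
    _ ≤ 4 * (c + ε) * a ^ 2 := by
      gcongr
      exact le_add_of_nonneg_right hε.le
    _ = 4 * √(c + ε) ^ 2 * a ^ 2 := by rw [Real.sq_sqrt hpos.le]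
    _ = (a * (2 * √(c + ε))) ^ 2 := by ring

/-- The square root need not be differentiable at the zeros of `f`, so the estimate is proved for
`√(f + ε²)` first. -/
theorem sqrt_le_integral_of_sq_deriv_le {f f' s : ℝ → ℝ} {a b : ℝ} (hab : a ≤ b)
    (hs : IntegrableOn s (Icc a b)) (hs₀ : ∀ t ∈ Icc a b, 0 ≤ s t) (hf₀ : ∀ t ∈ Icc a b, 0 ≤ f t)
    (hf : ∀ t ∈ Icc a b, HasDerivAt f (f' t) t)
    (hle : ∀ t ∈ Icc a b, f' t ^ 2 ≤ 4 * f t * s t ^ 2) (hfa : f a = 0) :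
    √(f b) ≤ ∫ t in a..b, s t := by
  refine le_of_forall_pos_le_add fun ε hε => ?_
  have hderiv : ∀ t ∈ Icc a b, HasDerivAt (fun t => √(f t + ε ^ 2))
      (f' t / (2 * √(f t + ε ^ 2))) t := fun t ht =>
    ((hf t ht).add_const (ε ^ 2)).sqrt (add_pos_of_nonneg_of_pos (hf₀ t ht) (by positivity)).ne'
  have hgrowth := intervalIntegral.sub_le_integral_of_hasDeriv_right_of_le hab
    (fun t ht => (hderiv t ht).continuousAt.continuousWithinAt)
    (fun t ht => (hderiv t (Ioo_subset_Icc_self ht)).hasDerivWithinAt) hs fun t ht =>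
      have ht' := Ioo_subset_Icc_self ht
      div_two_mul_sqrt_le (hs₀ t ht') (hf₀ t ht') (by positivity) (hle t ht')
  rw [hfa, zero_add, Real.sqrt_sq hε.le] at hgrowth
  have hb : √(f b) ≤ √(f b + ε ^ 2) := Real.sqrt_le_sqrt (le_add_of_nonneg_right (by positivity))
  linarith

end Eikonal

section LocalMinimizers

variable {n : ℕ} {M : Type*} [MetricSpace M] [ChartedSpace (𝔼 n) M]

theorem exists_ball_subset_chart (p : M) {r : ℝ} (hr : 0 < r) :
    ∃ δ > 0, Metric.ball p δ ⊆ (chartAt (𝔼 n) p).source ∩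
      extChartAt (𝓡 n) p ⁻¹' Metric.ball (extChartAt (𝓡 n) p p) r :=
  Metric.mem_nhds_iff.1 <| Filter.inter_mem (chart_source_mem_nhds _ p) <|
    (continuousAt_extChartAt p).preimage_mem_nhds (Metric.ball_mem_nhds _ hr)

variable [IsManifold (𝓡 n) ∞ M] [RiemannianBundle (fun x : M => TangentSpace (𝓡 n) x)]

/-- A geodesic whose velocity at some time is `v` is at `q` after a further time `s`. This is a
statement about all such geodesics; their existence is not part of it. -/
def ReachesAt (v : UnitTangentBundle n M) (s : ℝ) (q : M) : Prop :=
  ∀ (γ : ℝ → M) (t₀ : ℝ), IsGeodesic n γ → velocity n γ t₀ = v.1 → γ (t₀ + s) = q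

variable [IsContMDiffRiemannianBundle (𝓡 n) ∞ (𝔼 n) (fun x : M => TangentSpace (𝓡 n) x)]
  {p q : M} {r δ : ℝ} {R : 𝔼 n → 𝔼 n}

namespace IsLocalLog

theorem sqrt_le_arcLength (hR : IsLocalLog (chartMetric n p) (extChartAt (𝓡 n) p p) r R)
    {γ : ℝ → M} (hγ : ContMDiff 𝓘(ℝ, ℝ) (𝓡 n) 1 γ) (h0 : γ 0 = p)
    (hmem : ∀ t ∈ Icc (0 : ℝ) 1, γ t ∈ (chartAt (𝔼 n) p).source ∩
      extChartAt (𝓡 n) p ⁻¹' Metric.ball (extChartAt (𝓡 n) p p) r) :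
    √(energy (chartMetric n p) (extChartAt (𝓡 n) p p, R (extChartAt (𝓡 n) p (γ 1)))) ≤
      arcLength n γ 0 1 := by
  have hG := isMetricOn_chartMetric (n := n) p
  have heikonal := hR.eikonal
  choose! F' hF' hF'_le using heikonal
  let F : 𝔼 n → ℝ := fun y => chartMetric n p (extChartAt (𝓡 n) p p) (R y) (R y)
  refine sqrt_le_integral_of_sq_deriv_le (f := fun t => F (extChartAt (𝓡 n) p (γ t)))
    zero_le_one (continuous_speed hγ).integrableOn_Icc
    (fun _ _ => norm_nonneg _) (fun t _ => hG.nonneg (mem_extChartAt_target p) _)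
    (fun t ht => HasFDerivAt.comp_hasDerivAt (E := ℝ) (l := F) t (hF' _ (hmem t ht).2)
      (hasDerivAt_extChartAt_comp (hγ.mdifferentiable one_ne_zero t) (hmem t ht).1))
    (fun t ht => ?_) ?_
  · rw [norm_sq_eq_chartMetric (V := velocity n γ t) (hmem t ht).1]
    exact hF'_le _ (hmem t ht).2 _
  · simp only [F, h0, hR.map_self, map_zero]

variable [IsRiemannianManifold (𝓡 n) M]

theorem sqrt_le_dist (hR : IsLocalLog (chartMetric n p) (extChartAt (𝓡 n) p p) r R)
    (hδ : Metric.ball p δ ⊆ (chartAt (𝔼 n) p).source ∩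
      extChartAt (𝓡 n) p ⁻¹' Metric.ball (extChartAt (𝓡 n) p p) r) (hq : q ∈ Metric.ball p δ) :
    √(energy (chartMetric n p) (extChartAt (𝓡 n) p p, R (extChartAt (𝓡 n) p q))) ≤ dist p q := by
  refine le_of_forall_gt_imp_ge_of_dense fun a ha => ?_
  obtain ⟨σ, hσ, h0, h1, hlength⟩ :=
    exists_arcLength_lt (n := n) (lt_min ha (Metric.mem_ball'.1 hq))
  have hmem : ∀ t ∈ Icc (0 : ℝ) 1, σ t ∈ Metric.ball p δ := fun t ht => by
    have hsum := dist_add_dist_le_arcLength hσ ht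
    rw [h0] at hsum
    exact Metric.mem_ball'.2 (((le_add_of_nonneg_right dist_nonneg).trans hsum).trans_lt
      (hlength.trans_le (min_le_right _ _)))
  have hle := hR.sqrt_le_arcLength hσ h0 fun t ht => hδ (hmem t ht)
  rw [h1] at hle
  exact hle.trans (hlength.le.trans (min_le_left _ _))

theorem eq_of_isGeodesic (hR : IsLocalLog (chartMetric n p) (extChartAt (𝓡 n) p p) r R)
    (hδ : Metric.ball p δ ⊆ (chartAt (𝔼 n) p).source ∩
      extChartAt (𝓡 n) p ⁻¹' Metric.ball (extChartAt (𝓡 n) p p) r) (hq : q ∈ Metric.ball p δ)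
    {γ : ℝ → M} (hγ : IsGeodesic n γ) {t₀ ℓ : ℝ} (hℓ : 0 < ℓ) (hℓδ : ℓ < δ)
    (hvel : velocity n γ t₀ = ⟨p, (ℓ⁻¹ • R (extChartAt (𝓡 n) p q) : 𝔼 n)⟩) :
    γ (t₀ + ℓ) = q := by
  have hfoot : γ t₀ = p := congrArg TotalSpace.proj hvel
  have hmem : ∀ t ∈ Icc 0 ℓ, γ (t₀ + t) ∈ Metric.ball p δ := fun t ht => by
    have hdist := hγ.dist_le t₀ (t₀ + t)
    rw [hfoot, sub_add_cancel_left, abs_neg, abs_of_nonneg ht.1] at hdist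
    exact Metric.mem_ball'.2 (hdist.trans_lt (ht.2.trans_lt hℓδ))
  have hreach := hR.reaches _ (hδ hq).2 ℓ hℓ
    (fun t => tangentChart p (velocity n γ (t₀ + t)))
    (by simp only [add_zero, hvel]; exact tangentChart_self p _) fun t ht =>
    ⟨(hδ (hmem t ht)).2,
      (hγ.hasDerivAt_tangentChart (hδ (hmem t ht)).1).comp_const_add t₀ t⟩
  refine (extChartAt (𝓡 n) p).injOn ?_ ?_ hreach <;> rw [extChartAt_source]
  exacts [(hδ (hmem ℓ ⟨hℓ.le, le_rfl⟩)).1, (hδ hq).1]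

end IsLocalLog

variable [IsRiemannianManifold (𝓡 n) M]

theorem exists_reachesAt_dist (p : M) : ∃ δ > 0, ∀ q ≠ p, dist p q < δ →
    ∃ v : UnitTangentBundle n M, v.1.proj = p ∧ ReachesAt v (dist p q) q := by
  obtain ⟨r, R, -, hR⟩ :=
    (isMetricOn_chartMetric (n := n) p).exists_isLocalLog (mem_extChartAt_target p)
  obtain ⟨δ, hδ, hball⟩ := exists_ball_subset_chart (n := n) p hR.radius_pos
  refine ⟨δ, hδ, fun q hqp hq => ?_⟩
  have hqδ : q ∈ Metric.ball p δ := Metric.mem_ball'.2 hq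
  set y := extChartAt (𝓡 n) p q
  let X : TangentSpace (𝓡 n) p := R y
  have hX : 0 < ‖X‖ := norm_pos_iff.2 fun hRy => hqp <| (extChartAt (𝓡 n) p).injOn
    (by simpa only [extChartAt_source] using (hball hqδ).1) (mem_extChartAt_source p)
    (hR.eq_of_map_eq_zero y (hball hqδ).2 hRy)
  have hX_le : ‖X‖ ≤ dist p q := (norm_eq_sqrt_energy p X).trans_le (hR.sqrt_le_dist hball hqδ)
  let v : UnitTangentBundle n M := ⟨⟨p, ‖X‖⁻¹ • X⟩, norm_smul_inv_norm (norm_pos_iff.1 hX)⟩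
  have hreach : ReachesAt v ‖X‖ q := fun γ t₀ hγ hvel =>
    hR.eq_of_isGeodesic hball hqδ hγ hX (hX_le.trans_lt hq) hvel
  refine ⟨v, rfl, fun γ t₀ hγ hvel => ?_⟩
  have hend : γ (t₀ + ‖X‖) = q := hreach γ t₀ hγ hvel
  have hstart : γ t₀ = p := congrArg TotalSpace.proj hvel
  have hdist := hγ.dist_le t₀ (t₀ + ‖X‖)
  rw [hend, hstart, sub_add_cancel_left, abs_neg, abs_norm] at hdist
  rw [le_antisymm hdist hX_le, hend]

end LocalMinimizers

section InfinitesimalDistance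

namespace IsMetricOn

variable {E : Type*} [NormedAddCommGroup E] [NormedSpace ℝ E]
  {G : E → E →L[ℝ] E →L[ℝ] ℝ} {U : Set E} {x : E}

theorem eventually_le_add (hG : IsMetricOn G U) (hx : x ∈ U) {ε : ℝ} (hε : 0 < ε) :
    ∀ᶠ y in 𝓝 x, ∀ h, G y h h ≤ G x h h + ε * ‖h‖ ^ 2 := by
  filter_upwards [(hG.contDiffAt hx).continuousAt.preimage_mem_nhds (Metric.ball_mem_nhds _ hε)]
    with y hy h
  have hnorm : ‖G y - G x‖ ≤ ε := by
    simpa only [mem_preimage, Metric.mem_ball, dist_eq_norm] using (mem_ball_iff_norm.1 hy).le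
  have hop : (G y - G x) h h ≤ ε * ‖h‖ * ‖h‖ :=
    (le_abs_self _).trans (((G y - G x).le_opNorm₂ h h).trans (by gcongr))
  rw [sub_apply, sub_apply] at hop
  linarith [sq ‖h‖, mul_assoc ε ‖h‖ ‖h‖]

theorem eq_of_four_le (hG : IsMetricOn G U) (hx : x ∈ U) {v w : E} (hv : G x v v = 1)
    (hw : G x w w = 1) (h : 4 ≤ G x (v + w) (v + w)) : v = w := by
  by_contra hne
  have hpos := hG.pos x hx (v - w) (sub_ne_zero.2 hne)
  simp only [map_add, map_sub, add_apply, sub_apply] at hpos h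
  linarith [hG.symm x v w]

end IsMetricOn

theorem sq_le_of_eventually_sq_le {E : Type*} [NormedAddCommGroup E] [NormedSpace ℝ E]
    {Q : E → ℝ} (hQ : Continuous Q) (hQ_smul : ∀ (s : ℝ) v, Q (s • v) = s ^ 2 * Q v) {d : ℝ → E}
    {d' : E} (hd : HasDerivAt d d' 0) (hd₀ : d 0 = 0) {k : ℝ}
    (hk : ∀ᶠ s in 𝓝[>] 0, (k * s) ^ 2 ≤ Q (d s)) : k ^ 2 ≤ Q d' := by
  have hslope : Filter.Tendsto (fun s : ℝ => s⁻¹ • d s) (𝓝[>] 0) (𝓝 d') := by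
    simpa only [hd₀, zero_add, sub_zero] using hd.tendsto_slope_zero_right
  refine ge_of_tendsto ((hQ.tendsto d').comp hslope) ?_
  filter_upwards [hk, self_mem_nhdsWithin] with s hs hs₀
  have hs_pos : 0 < s := hs₀
  rw [Function.comp_apply, hQ_smul, inv_pow, inv_mul_eq_div, le_div_iff₀ (by positivity),
    ← mul_pow]
  exact hs

variable {n : ℕ} {M : Type*} [MetricSpace M] [ChartedSpace (𝔼 n) M]
  [IsManifold (𝓡 n) ∞ M] [RiemannianBundle (fun x : M => TangentSpace (𝓡 n) x)] {p : M}

theorem norm_velocity_extChartAt_symm_sq {c : ℝ → 𝔼 n} {c' : 𝔼 n} {t : ℝ}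
    (hc : HasDerivAt c c' t) (ht : c t ∈ (extChartAt (𝓡 n) p).target) :
    ‖(velocity n (fun s => (extChartAt (𝓡 n) p).symm (c s)) t).2‖ ^ 2 =
      chartMetric n p (c t) c' c' := by
  have hsymm : MDifferentiableAt (𝓡 n) (𝓡 n) (extChartAt (𝓡 n) p).symm (c t) :=
    ((contMDiffOn_extChartAt_symm (n := 1) p).contMDiffAt
      ((isOpen_extChartAt_target p).mem_nhds ht)).mdifferentiableAt one_ne_zero
  have hsource := extChartAt_symm_mem_source ht
  have hchart := hasDerivAt_extChartAt_comp (p := p)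
    (hsymm.comp t hc.differentiableAt.mdifferentiableAt) hsource
  have hcancel : (fun s => extChartAt (𝓡 n) p ((extChartAt (𝓡 n) p).symm (c s))) =ᶠ[𝓝 t] c := by
    filter_upwards [hc.continuousAt.preimage_mem_nhds
      ((isOpen_extChartAt_target p).mem_nhds ht)] with s hs
    exact (extChartAt (𝓡 n) p).right_inv hs
  have hcoord := (hchart.congr_of_eventuallyEq hcancel.symm).unique hc
  have hnorm := norm_sq_eq_chartMetric (p := p)
    (V := velocity n (fun s => (extChartAt (𝓡 n) p).symm (c s)) t) hsource
  rw [hnorm]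
  exact congrArg₂ (fun y u => chartMetric n p y u u) hcancel.self_of_nhds hcoord

variable [IsRiemannianManifold (𝓡 n) M]

theorem dist_extChartAt_symm_sq_le {y z : 𝔼 n} {K : ℝ} (hK : 0 ≤ K)
    (h : ∀ x ∈ segment ℝ y z, x ∈ (extChartAt (𝓡 n) p).target ∧
      chartMetric n p x (z - y) (z - y) ≤ K) :
    dist ((extChartAt (𝓡 n) p).symm y) ((extChartAt (𝓡 n) p).symm z) ^ 2 ≤ K := by
  let c : ℝ → 𝔼 n := AffineMap.lineMap y z
  have hc : ∀ t ∈ Icc (0 : ℝ) 1, c t ∈ (extChartAt (𝓡 n) p).target ∧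
      chartMetric n p (c t) (z - y) (z - y) ≤ K := fun t ht => h _ <| by
    rw [segment_eq_image_lineMap]
    exact mem_image_of_mem _ ht
  have hsmooth : ContMDiffOn 𝓘(ℝ, ℝ) (𝓡 n) 1 (fun t => (extChartAt (𝓡 n) p).symm (c t))
      (Icc 0 1) :=
    (contMDiffOn_extChartAt_symm (n := 1) p).comp
      (AffineMap.contDiff_lineMap y z).contMDiff.contMDiffOn fun t ht => (hc t ht).1
  have hspeed : ∀ t ∈ Ioo (0 : ℝ) 1,
      ‖(velocity n (fun s => (extChartAt (𝓡 n) p).symm (c s)) t).2‖ ≤ √K := fun t ht => by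
    obtain ⟨htarget, hle⟩ := hc t (Ioo_subset_Icc_self ht)
    refine Real.le_sqrt_of_sq_le ?_
    rwa [norm_velocity_extChartAt_symm_sq AffineMap.hasDerivAt_lineMap htarget]
  have hdist := dist_le_of_speed_le zero_le_one hsmooth (Real.sqrt_nonneg K) hspeed
  simp only [c, AffineMap.lineMap_apply_zero, AffineMap.lineMap_apply_one, sub_zero,
    mul_one] at hdist
  exact (Real.le_sqrt dist_nonneg hK).1 hdist

variable [IsContMDiffRiemannianBundle (𝓡 n) ∞ (𝔼 n) (fun x : M => TangentSpace (𝓡 n) x)]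

variable (n) in
theorem eventually_dist_sq_le (p : M) {ε : ℝ} (hε : 0 < ε) :
    ∀ᶠ z : M × M in 𝓝 (p, p), dist z.1 z.2 ^ 2 ≤
      chartMetric n p (extChartAt (𝓡 n) p p)
          (extChartAt (𝓡 n) p z.2 - extChartAt (𝓡 n) p z.1)
          (extChartAt (𝓡 n) p z.2 - extChartAt (𝓡 n) p z.1) +
        ε * ‖extChartAt (𝓡 n) p z.2 - extChartAt (𝓡 n) p z.1‖ ^ 2 := by
  have hG := isMetricOn_chartMetric (n := n) p
  have hp := mem_extChartAt_target (I := 𝓡 n) p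
  obtain ⟨ρ, hρ, hball⟩ := Metric.mem_nhds_iff.1
    ((hG.isOpen.eventually_mem hp).and (hG.eventually_le_add hp hε))
  have hnear : ∀ᶠ q in 𝓝 p, q ∈ (chartAt (𝔼 n) p).source ∧
      extChartAt (𝓡 n) p q ∈ Metric.ball (extChartAt (𝓡 n) p p) ρ :=
    (Filter.eventually_mem_set.2 (chart_source_mem_nhds _ p)).and
      ((continuousAt_extChartAt p).eventually_mem (Metric.ball_mem_nhds _ hρ))
  filter_upwards [hnear.prod_nhds hnear] with ⟨q, q'⟩ ⟨⟨hq, hqρ⟩, ⟨hq', hqρ'⟩⟩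
  have hle := dist_extChartAt_symm_sq_le (p := p)
    (add_nonneg (hG.nonneg hp (extChartAt (𝓡 n) p q' - extChartAt (𝓡 n) p q))
      (by positivity : 0 ≤ ε * ‖extChartAt (𝓡 n) p q' - extChartAt (𝓡 n) p q‖ ^ 2))
    fun x hx => have hx' := hball ((convex_ball _ ρ).segment_subset hqρ hqρ' hx); ⟨hx'.1, hx'.2 _⟩
  rwa [extChartAt_symm_extChartAt hq, extChartAt_symm_extChartAt hq'] at hle

theorem sq_le_chartMetric_sub {α β : ℝ → M} (hα₀ : α 0 = p) (hβ₀ : β 0 = p)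
    (hα : ContinuousAt α 0) (hβ : ContinuousAt β 0) {a' b' : 𝔼 n}
    (ha : HasDerivAt (fun s => extChartAt (𝓡 n) p (α s)) a' 0)
    (hb : HasDerivAt (fun s => extChartAt (𝓡 n) p (β s)) b' 0) {k : ℝ} (hk : 0 ≤ k)
    (h : ∀ᶠ s in 𝓝[>] (0 : ℝ), k * s ≤ dist (α s) (β s)) :
    k ^ 2 ≤ chartMetric n p (extChartAt (𝓡 n) p p) (b' - a') (b' - a') := by
  set G₀ := chartMetric n p (extChartAt (𝓡 n) p p)
  have hbound : ∀ ε > 0, k ^ 2 ≤ G₀ (b' - a') (b' - a') + ε * ‖b' - a'‖ ^ 2 := fun ε hε => by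
    refine sq_le_of_eventually_sq_le (Q := fun h => G₀ h h + ε * ‖h‖ ^ 2) (by fun_prop)
      (fun s h => ?_) (hb.fun_sub ha) ?_ ?_
    · simp only [map_smul, smul_apply, smul_eq_mul, norm_smul, mul_pow, Real.norm_eq_abs, sq_abs]
      ring
    · rw [hα₀, hβ₀, sub_self]
    · have hlim : Filter.Tendsto (fun s => (α s, β s)) (𝓝[>] 0) (𝓝 (p, p)) := by
        have hcont := (hα.prodMk hβ).continuousWithinAt (s := Ioi 0)
        simpa only [ContinuousWithinAt, hα₀, hβ₀] using hcont
      filter_upwards [h, hlim.eventually (eventually_dist_sq_le n p hε), self_mem_nhdsWithin]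
        with s hs hle hs₀
      have hs_pos : 0 < s := hs₀
      exact (pow_le_pow_left₀ (by positivity) hs 2).trans hle
  have hlim : Filter.Tendsto (fun ε => G₀ (b' - a') (b' - a') + ε * ‖b' - a'‖ ^ 2) (𝓝[>] 0)
      (𝓝 (G₀ (b' - a') (b' - a') + 0 * ‖b' - a'‖ ^ 2)) :=
    Filter.Tendsto.mono_left (Continuous.tendsto (by fun_prop) 0) nhdsWithin_le_nhds
  rw [zero_mul, add_zero] at hlim
  exact ge_of_tendsto hlim (eventually_nhdsWithin_of_forall hbound)

end InfinitesimalDistance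

section HopfRinow

variable {n : ℕ} {M : Type*} [MetricSpace M] [ChartedSpace (𝔼 n) M]
  [IsManifold (𝓡 n) ∞ M] [RiemannianBundle (fun x : M => TangentSpace (𝓡 n) x)]
  [IsContMDiffRiemannianBundle (𝓡 n) ∞ (𝔼 n) (fun x : M => TangentSpace (𝓡 n) x)]
  [IsRiemannianManifold (𝓡 n) M]

theorem IsGeodesic.velocity_eq_of_minimal {α β : ℝ → M} (hα : IsGeodesic n α)
    (hβ : IsGeodesic n β) {t₀ t₁ : ℝ} (hp : α t₀ = β t₁)
    (h : ∀ᶠ s in 𝓝[>] (0 : ℝ), 2 * s ≤ dist (α (t₀ - s)) (β (t₁ + s))) :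
    velocity n α t₀ = velocity n β t₁ := by
  have hα_source : α t₀ ∈ (chartAt (𝔼 n) (α t₀)).source := mem_chart_source _ _
  have hβ_source : β t₁ ∈ (chartAt (𝔼 n) (α t₀)).source := hp ▸ hα_source
  let v := tangentCoord (α t₀) (velocity n α t₀)
  let w := tangentCoord (α t₀) (velocity n β t₁)
  have hα_deriv : HasDerivAt (fun s => extChartAt (𝓡 n) (α t₀) (α (t₀ - s))) (-v) 0 :=
    HasDerivAt.comp_const_sub (F := 𝔼 n) t₀ 0 <| by
      rw [sub_zero]
      exact hasDerivAt_extChartAt_comp (hα.smooth.mdifferentiable (by decide) t₀) hα_source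
  have hβ_deriv : HasDerivAt (fun s => extChartAt (𝓡 n) (α t₀) (β (t₁ + s))) w 0 :=
    HasDerivAt.comp_const_add (F := 𝔼 n) t₁ 0 <| by
      rw [add_zero]
      exact hasDerivAt_extChartAt_comp (hβ.smooth.mdifferentiable (by decide) t₁) hβ_source
  have hspeed : 2 ^ 2 ≤ chartMetric n (α t₀) (extChartAt (𝓡 n) (α t₀) (α t₀)) (w - -v) (w - -v) :=
    sq_le_chartMetric_sub (α := fun s => α (t₀ - s)) (β := fun s => β (t₁ + s))
      (congrArg α (sub_zero t₀))
      ((congrArg β (add_zero t₁)).trans hp.symm)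
      (hα.smooth.continuous.comp (continuous_sub_left t₀)).continuousAt
      (hβ.smooth.continuous.comp (continuous_const_add t₁)).continuousAt
      hα_deriv hβ_deriv zero_le_two h
  have hv := (norm_sq_eq_chartMetric (V := velocity n α t₀) hα_source).symm
  have hw := (norm_sq_eq_chartMetric (V := velocity n β t₁) hβ_source).symm
  rw [hα.unit_speed, one_pow] at hv
  rw [hβ.unit_speed, one_pow] at hw
  change chartMetric n (α t₀) (extChartAt (𝓡 n) (α t₀) (β t₁)) w w = 1 at hw
  rw [← hp] at hw
  have hvw : w = v := (isMetricOn_chartMetric (α t₀)).eq_of_four_le (mem_extChartAt_target _)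
    hw hv (by rw [sub_neg_eq_add] at hspeed; linarith)
  calc velocity n α t₀ = ofCoord (α t₀) (extChartAt (𝓡 n) (α t₀) (α t₀)) v :=
        (ofCoord_tangentCoord hα_source).symm
    _ = ofCoord (α t₀) (extChartAt (𝓡 n) (α t₀) (β t₁)) w := by rw [hvw, ← hp]
    _ = velocity n β t₁ := ofCoord_tangentCoord (V := velocity n β t₁) hβ_source

section DistanceSplitting

variable (n)
include n

variable {p y : M}

theorem exists_dist_eq_and_dist_le {s a : ℝ} (hs : s ∈ Icc 0 (dist p y)) (ha : dist p y < a) :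
    ∃ z, dist p z = s ∧ dist z y ≤ a - s := by
  obtain ⟨σ, hσ, h0, h1, hlength⟩ := exists_arcLength_lt (n := n) ha
  obtain ⟨t, ht, hts⟩ := intermediate_value_Icc zero_le_one (f := fun t => dist p (σ t))
    (continuous_const.dist hσ.continuous).continuousOn
    (show s ∈ Icc (dist p (σ 0)) (dist p (σ 1)) by rwa [h0, h1, dist_self])
  have hsum := dist_add_dist_le_arcLength hσ ht
  rw [h0, h1, show dist p (σ t) = s from hts] at hsum
  exact ⟨σ t, hts, by linarith⟩

theorem exists_dist_eq_sub {s : ℝ} (hsphere : IsCompact (Metric.sphere p s))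
    (hs : s ∈ Icc 0 (dist p y)) : ∃ q, dist p q = s ∧ dist q y = dist p y - s := by
  have hne : (Metric.sphere p s).Nonempty := by
    obtain ⟨z, hz, -⟩ := exists_dist_eq_and_dist_le n hs (lt_add_one _)
    exact ⟨z, Metric.mem_sphere'.2 hz⟩
  obtain ⟨q, hq, hmin⟩ := hsphere.exists_isMinOn hne (f := fun z => dist z y)
    (continuous_id.dist continuous_const).continuousOn
  rw [Metric.mem_sphere'] at hq
  refine ⟨q, hq, le_antisymm (le_of_forall_gt_imp_ge_of_dense fun a ha => ?_) ?_⟩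
  · obtain ⟨z, hz, hzy⟩ := exists_dist_eq_and_dist_le n hs (sub_lt_iff_lt_add.1 ha)
    exact (isMinOn_iff.1 hmin z (Metric.mem_sphere'.2 hz)).trans (by linarith)
  · linarith [dist_triangle p q y]

theorem exists_reachesAt_dist_eq_sub (p : M) {y : M} {b : ℝ} (hb : 0 < b) (hby : b ≤ dist p y) :
    ∃ s ∈ Ioo 0 b, ∃ v : UnitTangentBundle n M, v.1.proj = p ∧
      ∃ q, ReachesAt v s q ∧ dist q y = dist p y - s := by
  have : LocallyCompactSpace M := ChartedSpace.locallyCompactSpace (𝔼 n) M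
  obtain ⟨r, hr, hcompact⟩ := Metric.exists_isCompact_closedBall p
  obtain ⟨δ, hδ, hreach⟩ := exists_reachesAt_dist (n := n) p
  obtain ⟨s, hs, hsm⟩ := exists_between (lt_min hb (lt_min hδ hr))
  obtain ⟨hsb, hsδ, hsr⟩ : s < b ∧ s < δ ∧ s < r := by simpa only [lt_min_iff] using hsm
  have hsphere : IsCompact (Metric.sphere p s) :=
    hcompact.of_isClosed_subset Metric.isClosed_sphere
      (Metric.sphere_subset_closedBall.trans (Metric.closedBall_subset_closedBall hsr.le))
  obtain ⟨q, hq, hqy⟩ := exists_dist_eq_sub n hsphere ⟨hs.le, hsb.le.trans hby⟩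
  obtain ⟨v, hv, hvq⟩ := hreach q (dist_pos.1 (hq ▸ hs)).symm (hq ▸ hsδ)
  exact ⟨s, ⟨hs, hsb⟩, v, hv, q, hq ▸ hvq, hqy⟩

end DistanceSplitting

theorem IsGeodesic.velocity_eq_of_dist_eq_sub {α β : ℝ → M} (hα : IsGeodesic n α)
    (hβ : IsGeodesic n β) {y : M} {t u : ℝ} (ht : 0 < t) (hu : 0 < u) (hp : β 0 = α t)
    (hα_dist : dist (α t) y = dist (α 0) y - t) (hβ_dist : dist (β u) y = dist (β 0) y - u) :
    velocity n α t = velocity n β 0 := by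
  refine hα.velocity_eq_of_minimal hβ hp.symm ?_
  filter_upwards [Ioo_mem_nhdsGT (lt_min ht hu)] with s hs
  obtain ⟨hst, hsu⟩ := lt_min_iff.1 hs.2
  have hbefore := hα.dist_le 0 (t - s)
  rw [abs_sub_comm, sub_zero, abs_of_pos (sub_pos.2 hst)] at hbefore
  have hafter := hβ.dist_le (0 + s) u
  rw [zero_add, abs_sub_comm, abs_of_pos (sub_pos.2 hsu)] at hafter
  rw [zero_add]
  have hsplit : dist (α 0) y ≤
      dist (α 0) (α (t - s)) + dist (α (t - s)) (β s) + dist (β s) (β u) + dist (β u) y := by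
    linarith [dist_triangle (α 0) (α (t - s)) y, dist_triangle4 (α (t - s)) (β s) (β u) y]
  rw [hp] at hβ_dist
  linarith

theorem IsGeodesicFlow.exists_proj_eq {Φ : ℝ → UnitTangentBundle n M → UnitTangentBundle n M}
    (hΦ : IsGeodesicFlow Φ) {x y : M} (hxy : x ≠ y) :
    ∃ v : UnitTangentBundle n M, v.1.proj = x ∧ (Φ (dist x y) v).1.proj = y := by
  obtain ⟨s, ⟨hs, hsr⟩, v, rfl, q, hvq, hqy⟩ :=
    exists_reachesAt_dist_eq_sub n x (dist_pos.2 hxy) le_rfl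
  obtain ⟨γ, hγ, hγv, hΦγ⟩ := hΦ v
  refine ⟨v, rfl, (congrArg TotalSpace.proj (hΦγ _)).trans ?_⟩
  have hγ₀ : γ 0 = v.1.proj := congrArg TotalSpace.proj hγv
  have hγs : γ s = q := by simpa only [zero_add] using hvq γ 0 hγ hγv
  set r := dist v.1.proj y
  let A := Icc 0 r ∩ {t | dist (γ t) y = r - t}
  have hA : IsCompact A := isCompact_Icc.inter_right <|
    isClosed_eq (hγ.smooth.continuous.dist continuous_const) (continuous_const.sub continuous_id)
  have hsA : s ∈ A := ⟨⟨hs.le, hsr.le⟩, (congrArg (dist · y) hγs).trans hqy⟩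
  obtain ⟨t, ⟨⟨ht₀, htr⟩, hty⟩, hmax⟩ := hA.exists_isGreatest ⟨s, hsA⟩
  have hty' : dist (γ t) y = r - t := hty
  rcases htr.eq_or_lt with rfl | hlt
  · exact dist_eq_zero.1 (hty'.trans (sub_self _))
  obtain ⟨u, ⟨hu, hur⟩, w, hw, q', hwq', hq'y⟩ :=
    exists_reachesAt_dist_eq_sub n (γ t) (sub_pos.2 hlt) hty'.ge
  obtain ⟨β, hβ, hβw, -⟩ := hΦ w
  have hβ₀ : β 0 = γ t := (congrArg TotalSpace.proj hβw).trans hw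
  have hβu : β u = q' := by simpa only [zero_add] using hwq' β 0 hβ hβw
  have hvel : velocity n γ t = velocity n β 0 :=
    hγ.velocity_eq_of_dist_eq_sub hβ (hs.trans_le (hmax hsA)) hu hβ₀ (by rw [hγ₀, hty'])
      (by rw [hβu, hβ₀, hq'y])
  have hend : dist (γ (t + u)) y = r - (t + u) := by
    rw [hwq' γ t hγ (hvel.trans hβw), hq'y, hty', sub_sub]
  exact absurd (hmax ⟨⟨by linarith, by linarith⟩, hend⟩) (by linarith)

end HopfRinow

section SasakiNorm

section KoszulBounds

variable {E : Type*} [NormedAddCommGroup E] [NormedSpace ℝ E]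
  {G : E → E →L[ℝ] E →L[ℝ] ℝ} {U : Set E}

theorem abs_koszul_le (D : E →L[ℝ] E →L[ℝ] E →L[ℝ] ℝ) (a b c : E) :
    |koszul D a b c| ≤ 2 * ‖D‖ * ‖a‖ * ‖b‖ * ‖c‖ := by
  have hD : ∀ a b c, |D a b c| ≤ ‖D‖ * (‖a‖ * ‖b‖ * ‖c‖) := fun a b c => by
    rw [← mul_assoc, ← mul_assoc]
    exact ((D a).le_opNorm₂ b c).trans (by gcongr; exact D.le_opNorm a)
  have hacb := abs_le.1 (hD a c b)
  have hbac := abs_le.1 (hD b a c)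
  have hcab := abs_le.1 (hD c a b)
  rw [mul_right_comm] at hacb
  rw [mul_comm ‖b‖] at hbac
  rw [mul_rotate ‖c‖, mul_comm (‖a‖ * ‖b‖), mul_comm ‖c‖] at hcab
  have hnonneg : 0 ≤ ‖D‖ * (‖a‖ * ‖b‖ * ‖c‖) := by positivity
  rw [koszul_apply, abs_le]
  constructor <;> linarith only [hnonneg, hacb, hbac, hcab]

theorem norm_le_of_apply_eq_add_koszul {B : E →L[ℝ] E →L[ℝ] ℝ}
    {D : E →L[ℝ] E →L[ℝ] E →L[ℝ] ℝ} {m : ℝ} (hm : 0 < m) (hmB : ∀ a, m * ‖a‖ ^ 2 ≤ B a a)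
    {k u y v : E} (hk : B k k = B u k + koszul D y v k) :
    ‖k‖ ≤ (‖B‖ * ‖u‖ + 2 * ‖D‖ * ‖y‖ * ‖v‖) / m := by
  rw [le_div_iff₀' hm]
  rcases (norm_nonneg k).eq_or_lt with hk₀ | hk₀
  · rw [← hk₀, mul_zero]
    positivity
  · refine le_of_mul_le_mul_right ?_ hk₀
    calc m * ‖k‖ * ‖k‖ = m * ‖k‖ ^ 2 := by ring
      _ ≤ B u k + koszul D y v k := (hmB k).trans_eq hk
      _ ≤ ‖B‖ * ‖u‖ * ‖k‖ + 2 * ‖D‖ * ‖y‖ * ‖v‖ * ‖k‖ :=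
        add_le_add ((le_abs_self _).trans (B.le_opNorm₂ u k))
          ((le_abs_self _).trans (abs_koszul_le D y v k))
      _ = (‖B‖ * ‖u‖ + 2 * ‖D‖ * ‖y‖ * ‖v‖) * ‖k‖ := by ring

theorem sqrt_apply_self_add_le (B : E →L[ℝ] E →L[ℝ] ℝ) (a b : E) :
    √(B a a + B b b) ≤ √‖B‖ * (‖a‖ + ‖b‖) := by
  rw [← Real.sqrt_sq (by positivity : 0 ≤ ‖a‖ + ‖b‖), ← Real.sqrt_mul (norm_nonneg B)]
  refine Real.sqrt_le_sqrt ?_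
  calc B a a + B b b ≤ ‖B‖ * ‖a‖ * ‖a‖ + ‖B‖ * ‖b‖ * ‖b‖ :=
        add_le_add ((le_abs_self _).trans (B.le_opNorm₂ a a))
          ((le_abs_self _).trans (B.le_opNorm₂ b b))
    _ ≤ ‖B‖ * (‖a‖ + ‖b‖) ^ 2 := by
        linarith [show 0 ≤ ‖B‖ * ‖a‖ * ‖b‖ by positivity]

/-- An upper bound for the Sasaki norm of a tangent vector of `TM` in terms of its coordinates, at
the point with coordinates `z = (x, u)`, where `m` is a lower bound for the metric `G` at `x`. -/
def sasakiBound (G : E → E →L[ℝ] E →L[ℝ] ℝ) (m : ℝ) (z : E × E) : ℝ :=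
  √‖G z.1‖ * (1 + (‖G z.1‖ + 2 * ‖fderiv ℝ G z.1‖ * ‖z.2‖) / m)

theorem IsMetricOn.continuousAt_sasakiBound (hG : IsMetricOn G U) {z : E × E} (hz : z.1 ∈ U)
    (m : ℝ) : ContinuousAt (sasakiBound G m) z := by
  have hG₁ : ContinuousAt (fun z : E × E => G z.1) z :=
    (hG.contDiffAt hz).continuousAt.comp continuousAt_fst
  have hG₂ : ContinuousAt (fun z : E × E => fderiv ℝ G z.1) z :=
    (hG.contDiffAt_fderiv hz).continuousAt.comp (f := Prod.fst) continuousAt_fst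
  exact hG₁.norm.sqrt.mul (continuousAt_const.add ((hG₁.norm.add
    ((continuousAt_const.mul hG₂.norm).mul continuousAt_snd.norm)).div_const m))

end KoszulBounds

variable {n : ℕ} {M : Type*} [MetricSpace M] [ChartedSpace (𝔼 n) M]
  [IsManifold (𝓡 n) ∞ M] [RiemannianBundle (fun x : M => TangentSpace (𝓡 n) x)]

theorem sasakiNorm_eq (v : TangentBundle (𝓡 n) M) (ξ : TangentSpace (𝓡 n).tangent v) :
    sasakiNorm v ξ = √(‖dproj v ξ‖ ^ 2 + ‖connectionMap v ξ‖ ^ 2) := by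
  rw [sasakiNorm, sasakiInner, real_inner_self_eq_norm_sq, real_inner_self_eq_norm_sq]

theorem norm_dproj_le_sasakiNorm (v : TangentBundle (𝓡 n) M) (ξ : TangentSpace (𝓡 n).tangent v) :
    ‖dproj v ξ‖ ≤ sasakiNorm v ξ := by
  rw [sasakiNorm_eq]
  exact Real.le_sqrt_of_sq_le (le_add_of_nonneg_right (by positivity))

theorem edist_proj_le_sasakiEDist [IsRiemannianManifold (𝓡 n) M] (v w : UnitTangentBundle n M) :
    edist v.1.proj w.1.proj ≤ sasakiEDist v w := by
  refine le_iInf₂ fun c ⟨hc, _, hc₀, hc₁⟩ => ?_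
  have hproj : ContMDiffOn 𝓘(ℝ, ℝ) (𝓡 n) 1 (fun t => (c t).proj) (Icc 0 1) :=
    (contMDiff_proj (IB := 𝓡 n) (n := 1) (TangentSpace (𝓡 n) : M → Type _)).comp_contMDiffOn hc
  rw [IsRiemannianManifold.out (I := 𝓡 n)]
  refine (riemannianEDist_le_pathELength hproj (by rw [hc₀]) (by rw [hc₁]) zero_le_one).trans ?_
  rw [pathELength_eq_lintegral_mfderiv_Ioo, sasakiLength, ← restrict_Ioo_eq_restrict_Icc]
  refine setLIntegral_mono' measurableSet_Ioo fun t ht => ?_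
  have hct : MDifferentiableAt 𝓘(ℝ, ℝ) (𝓡 n).tangent c t :=
    (hc.contMDiffAt (Icc_mem_nhds ht.1 ht.2)).mdifferentiableAt one_ne_zero
  rw [← ofReal_norm]
  exact ENNReal.ofReal_le_ofReal
    ((congrArg norm (dproj_mfderiv hct)).symm.trans_le (norm_dproj_le_sasakiNorm _ _))

variable [IsContMDiffRiemannianBundle (𝓡 n) ∞ (𝔼 n) (fun x : M => TangentSpace (𝓡 n) x)]

theorem sasakiNorm_mfderiv_le {p : M} {V : ℝ → TangentBundle (𝓡 n) M} {t m : ℝ}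
    {z' : 𝔼 n × 𝔼 n} (hm : 0 < m)
    (hmG : ∀ a, m * ‖a‖ ^ 2 ≤ chartMetric n p (extChartAt (𝓡 n) p (V t).proj) a a)
    (hV : MDifferentiableAt 𝓘(ℝ, ℝ) (𝓡 n).tangent V t)
    (hp : (V t).proj ∈ (chartAt (𝔼 n) p).source)
    (hz : HasDerivAt (fun s => tangentChart p (V s)) z' t) :
    sasakiNorm (V t) (mfderiv 𝓘(ℝ, ℝ) (𝓡 n).tangent V t (1 : ℝ)) ≤
      sasakiBound (chartMetric n p) m (tangentChart p (V t)) * ‖z'‖ := by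
  let ξ := mfderiv 𝓘(ℝ, ℝ) (𝓡 n).tangent V t (1 : ℝ)
  let x := extChartAt (𝓡 n) p (V t).proj
  let k := tangentCoord p ⟨(V t).proj, connectionMap (V t) ξ⟩
  let u := tangentCoord p (V t)
  have hu : HasDerivAt (fun s => tangentCoord p (V s)) z'.2 t := hasDerivAt_snd hz
  have hfst : z'.1 = tangentCoord p (velocity n (fun s => (V s).proj) t) :=
    (hasDerivAt_fst hz).unique (hasDerivAt_extChartAt_comp (mdifferentiableAt_proj hV) hp)
  have hhorizontal : ‖dproj (V t) ξ‖ ^ 2 = chartMetric n p x z'.1 z'.1 := by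
    rw [hfst, dproj_mfderiv hV]
    exact norm_sq_eq_chartMetric (V := velocity n (fun s => (V s).proj) t) hp
  have hvertical : ‖connectionMap (V t) ξ‖ ^ 2 = chartMetric n p x k k :=
    norm_sq_eq_chartMetric (V := ⟨(V t).proj, connectionMap (V t) ξ⟩) hp
  have hk : chartMetric n p x k k = chartMetric n p x z'.2 k +
      koszul (fderiv ℝ (chartMetric n p) x) z'.1 u k := by
    rw [hfst]
    exact chartMetric_connectionMap hV hp hu k
  have hk_le : ‖k‖ ≤
      (‖chartMetric n p x‖ + 2 * ‖fderiv ℝ (chartMetric n p) x‖ * ‖u‖) / m * ‖z'‖ := by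
    refine (norm_le_of_apply_eq_add_koszul hm hmG hk).trans ?_
    rw [div_mul_eq_mul_div, add_mul, mul_right_comm _ ‖u‖]
    gcongr
    exacts [norm_snd_le z', norm_fst_le z']
  calc sasakiNorm (V t) ξ = √(chartMetric n p x z'.1 z'.1 + chartMetric n p x k k) := by
        rw [sasakiNorm_eq, hhorizontal, hvertical]
    _ ≤ √‖chartMetric n p x‖ * (‖z'.1‖ + ‖k‖) := sqrt_apply_self_add_le _ _ _
    _ ≤ √‖chartMetric n p x‖ * (‖z'‖ +
          (‖chartMetric n p x‖ + 2 * ‖fderiv ℝ (chartMetric n p) x‖ * ‖u‖) / m * ‖z'‖) := by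
        gcongr
        exact norm_fst_le z'
    _ = sasakiBound (chartMetric n p) m (tangentChart p (V t)) * ‖z'‖ := by
        rw [sasakiBound]
        simp only [tangentChart]
        ring

theorem exists_sasakiNorm_mfderiv_le {p : M} {z₀ : 𝔼 n × 𝔼 n}
    (hz₀ : z₀.1 ∈ (extChartAt (𝓡 n) p).target) :
    ∃ A, ∀ᶠ z in 𝓝 z₀, ∀ (V : ℝ → TangentBundle (𝓡 n) M) (t : ℝ) (z' : 𝔼 n × 𝔼 n),
      tangentChart p (V t) = z → (V t).proj ∈ (chartAt (𝔼 n) p).source →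
      MDifferentiableAt 𝓘(ℝ, ℝ) (𝓡 n).tangent V t →
      HasDerivAt (fun s => tangentChart p (V s)) z' t →
      sasakiNorm (V t) (mfderiv 𝓘(ℝ, ℝ) (𝓡 n).tangent V t (1 : ℝ)) ≤ A * ‖z'‖ := by
  have hG := isMetricOn_chartMetric (n := n) p
  obtain ⟨m, hm, hmG⟩ := hG.exists_lower_bound hz₀
  refine ⟨sasakiBound (chartMetric n p) m z₀ + 1, ?_⟩
  filter_upwards [continuousAt_fst.eventually hmG,
    (hG.continuousAt_sasakiBound hz₀ m).eventually_lt_const (lt_add_one _)]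
    with z hmz hbound V t z' hVz hp hV hz'
  subst hVz
  exact (sasakiNorm_mfderiv_le hm hmz hV hp hz').trans (by gcongr)

end SasakiNorm

section FiberNormalization

variable {E : Type*} [NormedAddCommGroup E] [NormedSpace ℝ E]
  {G : E → E →L[ℝ] E →L[ℝ] ℝ} {U : Set E} {z : E × E}

/-- The radial projection `(x, u) ↦ (x, u / |u|)` onto the unit tangent bundle of the metric `G`.
It is meaningful only where `0 < energy G z`. -/
def normalizeFiber (G : E → E →L[ℝ] E →L[ℝ] ℝ) (z : E × E) : E × E :=
  (z.1, (√(energy G z))⁻¹ • z.2)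

theorem energy_normalizeFiber (hz : 0 < energy G z) : energy G (normalizeFiber G z) = 1 := by
  rw [normalizeFiber, energy_smul, inv_pow, Real.sq_sqrt hz.le]
  exact inv_mul_cancel₀ hz.ne'

theorem normalizeFiber_of_energy_eq_one (hz : energy G z = 1) : normalizeFiber G z = z := by
  rw [normalizeFiber, hz, Real.sqrt_one, inv_one, one_smul]

theorem normalizeFiber_smul (G : E → E →L[ℝ] E →L[ℝ] ℝ) {s : ℝ} (hs : 0 < s) (x u : E) :
    normalizeFiber G (x, s • u) = normalizeFiber G (x, u) := by
  rw [normalizeFiber, normalizeFiber, energy_smul, Real.sqrt_mul (sq_nonneg s), Real.sqrt_sq hs.le,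
    smul_smul, mul_inv_rev, inv_mul_cancel_right₀ hs.ne']

theorem IsMetricOn.contDiffAt_normalizeFiber (hG : IsMetricOn G U) (hz : z.1 ∈ U)
    (henergy : 0 < energy G z) : ContDiffAt ℝ ∞ (normalizeFiber G) z :=
  contDiffAt_fst.prodMk ((((hG.contDiffAt_energy hz).sqrt henergy.ne').inv
    (Real.sqrt_pos.2 henergy).ne').smul contDiffAt_snd)

end FiberNormalization

section SasakiTopology

variable {n : ℕ} {M : Type*} [MetricSpace M] [ChartedSpace (𝔼 n) M] [IsManifold (𝓡 n) ∞ M]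
  {p : M} {z : 𝔼 n × 𝔼 n}

theorem tangentChart_ofCoord (hz : z.1 ∈ (extChartAt (𝓡 n) p).target) :
    tangentChart p (ofCoord p z.1 z.2) = z :=
  Prod.ext ((extChartAt (𝓡 n) p).right_inv hz) (tangentCoord_ofCoord hz z.2)

theorem contMDiffAt_ofCoord (hz : z.1 ∈ (extChartAt (𝓡 n) p).target) :
    ContMDiffAt 𝓘(ℝ, 𝔼 n × 𝔼 n) (𝓡 n).tangent 1
      (fun z : 𝔼 n × 𝔼 n => ofCoord p z.1 z.2) z := by
  have htarget := (isOpen_extChartAt_target (I := 𝓡 n) p).mem_nhds hz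
  have hsource : ofCoord p z.1 z.2 ∈ (trivializationAt (𝔼 n) (TangentSpace (𝓡 n)) p).source :=
    (Trivialization.mem_source _).2 (extChartAt_symm_mem_source hz)
  refine (Trivialization.contMDiffAt_iff (n := 1) (IB := 𝓡 n) (IM := 𝓘(ℝ, 𝔼 n × 𝔼 n))
    (f := fun z : 𝔼 n × 𝔼 n => ofCoord p z.1 z.2) hsource).2 ⟨?_, ?_⟩
  · exact ((contMDiffOn_extChartAt_symm (n := 1) p).contMDiffAt htarget).comp z
      contDiffAt_fst.contMDiffAt
  · refine (contDiffAt_snd (n := 1)).contMDiffAt.congr_of_eventuallyEq ?_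
    filter_upwards [continuousAt_fst.preimage_mem_nhds htarget] with z' hz'
    exact tangentCoord_ofCoord hz' z'.2

variable [RiemannianBundle (fun x : M => TangentSpace (𝓡 n) x)]

/-- The inverse of the chart `tangentChart p`, followed by the radial projection onto `SM`. -/
def unitOfCoord (p : M) (z : 𝔼 n × 𝔼 n) : TangentBundle (𝓡 n) M :=
  ofCoord p (normalizeFiber (chartMetric n p) z).1 (normalizeFiber (chartMetric n p) z).2

theorem norm_unitOfCoord (hz : 0 < energy (chartMetric n p) z) : ‖(unitOfCoord p z).2‖ = 1 := by
  refine (pow_eq_one_iff_of_nonneg (norm_nonneg _) two_ne_zero).1 ?_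
  exact (chartMetric_self p _ _).symm.trans (energy_normalizeFiber hz)

theorem tangentChart_unitOfCoord (hz : z.1 ∈ (extChartAt (𝓡 n) p).target) :
    tangentChart p (unitOfCoord p z) = normalizeFiber (chartMetric n p) z :=
  tangentChart_ofCoord (z := normalizeFiber (chartMetric n p) z) hz

variable (n M) in
theorem continuous_foot : Continuous fun v : UnitTangentBundle n M => v.1.proj :=
  (FiberBundle.continuous_proj (𝔼 n) (TangentSpace (𝓡 n) : M → Type _)).comp
    continuous_subtype_val

theorem continuousAt_tangentChart (v : UnitTangentBundle n M) :
    ContinuousAt (fun w : UnitTangentBundle n M => tangentChart v.1.proj w.1) v :=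
  ContinuousAt.comp (f := Subtype.val) (g := extChartAt (𝓡 n).tangent v.1)
    (continuousAt_extChartAt v.1) continuousAt_subtype_val

theorem energy_tangentChart_of_unit {v : UnitTangentBundle n M}
    (hv : v.1.proj ∈ (chartAt (𝔼 n) p).source) :
    energy (chartMetric n p) (tangentChart p v.1) = 1 := by
  rw [energy_tangentChart hv, v.2, one_pow]

theorem unitOfCoord_tangentChart {v : UnitTangentBundle n M}
    (hv : v.1.proj ∈ (chartAt (𝔼 n) p).source) : unitOfCoord p (tangentChart p v.1) = v.1 := by
  rw [unitOfCoord, normalizeFiber_of_energy_eq_one (energy_tangentChart_of_unit hv)]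
  exact ofCoord_tangentCoord hv

variable [IsContMDiffRiemannianBundle (𝓡 n) ∞ (𝔼 n) (fun x : M => TangentSpace (𝓡 n) x)]

theorem contMDiffAt_unitOfCoord (hz : z.1 ∈ (extChartAt (𝓡 n) p).target)
    (henergy : 0 < energy (chartMetric n p) z) :
    ContMDiffAt 𝓘(ℝ, 𝔼 n × 𝔼 n) (𝓡 n).tangent 1 (unitOfCoord p) z :=
  ContMDiffAt.comp z (contMDiffAt_ofCoord (z := normalizeFiber (chartMetric n p) z) hz)
    (((isMetricOn_chartMetric p).contDiffAt_normalizeFiber hz henergy).of_le (by simp)).contMDiffAt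

theorem eventually_energy_pos {z₀ : 𝔼 n × 𝔼 n} (hz₀ : z₀.1 ∈ (extChartAt (𝓡 n) p).target)
    (henergy : 0 < energy (chartMetric n p) z₀) :
    ∀ᶠ z in 𝓝 z₀, z.1 ∈ (extChartAt (𝓡 n) p).target ∧ 0 < energy (chartMetric n p) z :=
  (continuousAt_fst.eventually ((isOpen_extChartAt_target p).eventually_mem hz₀)).and
    (((isMetricOn_chartMetric p).contDiffAt_energy hz₀).continuousAt.eventually_const_lt henergy)

theorem exists_sasakiNorm_unitOfCoord_le {z₀ : 𝔼 n × 𝔼 n}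
    (hz₀ : z₀.1 ∈ (extChartAt (𝓡 n) p).target) (henergy : 0 < energy (chartMetric n p) z₀) :
    ∃ C, ∀ᶠ z in 𝓝 z₀, ∀ (ζ : ℝ → 𝔼 n × 𝔼 n) (t : ℝ) (ζ' : 𝔼 n × 𝔼 n),
      ζ t = z → HasDerivAt ζ ζ' t →
      sasakiNorm (unitOfCoord p (ζ t))
        (mfderiv 𝓘(ℝ, ℝ) (𝓡 n).tangent (fun s => unitOfCoord p (ζ s)) t (1 : ℝ)) ≤ C * ‖ζ'‖ := by
  let N := normalizeFiber (chartMetric n p)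
  have hN₀ : ContDiffAt ℝ ∞ N z₀ :=
    (isMetricOn_chartMetric p).contDiffAt_normalizeFiber hz₀ henergy
  obtain ⟨A, hA⟩ := exists_sasakiNorm_mfderiv_le (p := p) (z₀ := N z₀) hz₀
  have hfderiv : ContinuousAt (fun z => ‖fderiv ℝ N z‖) z₀ :=
    (hN₀.fderiv_right (m := 0) (by simp)).continuousAt.norm
  refine ⟨|A| * (‖fderiv ℝ N z₀‖ + 1), ?_⟩
  filter_upwards [hN₀.continuousAt.eventually hA, hfderiv.eventually_lt_const (lt_add_one _),
    (eventually_energy_pos hz₀ henergy).eventually_nhds] with z hzA hzL hzpos ζ t ζ' hζz hζ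
  subst hζz
  obtain ⟨htarget, hpos⟩ := hzpos.self_of_nhds
  have hchart : (fun s => tangentChart p (unitOfCoord p (ζ s))) =ᶠ[𝓝 t] fun s => N (ζ s) :=
    (hζ.continuousAt.eventually hzpos).mono fun s hs => tangentChart_unitOfCoord hs.1
  have hNζ : HasDerivAt (fun s => tangentChart p (unitOfCoord p (ζ s))) (fderiv ℝ N (ζ t) ζ') t :=
    (((((isMetricOn_chartMetric p).contDiffAt_normalizeFiber htarget hpos).differentiableAt
      (by simp)).hasFDerivAt).comp_hasDerivAt t hζ).congr_of_eventuallyEq hchart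
  have hmdiff : MDifferentiableAt 𝓘(ℝ, ℝ) (𝓡 n).tangent (fun s => unitOfCoord p (ζ s)) t :=
    ((contMDiffAt_unitOfCoord htarget hpos).mdifferentiableAt one_ne_zero).comp t
      hζ.differentiableAt.mdifferentiableAt
  calc _ ≤ A * ‖fderiv ℝ N (ζ t) ζ'‖ := hzA _ t _ (tangentChart_unitOfCoord htarget)
        (extChartAt_symm_mem_source htarget) hmdiff hNζ
    _ ≤ |A| * ((‖fderiv ℝ N z₀‖ + 1) * ‖ζ'‖) := by
        gcongr
        · exact le_abs_self A
        · exact ((fderiv ℝ N (ζ t)).le_opNorm ζ').trans (by gcongr)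
    _ = |A| * (‖fderiv ℝ N z₀‖ + 1) * ‖ζ'‖ := (mul_assoc _ _ _).symm

theorem sasakiEDist_le_of_segment {v w : UnitTangentBundle n M} {ζ : ℝ → 𝔼 n × 𝔼 n} {C : ℝ}
    (hv : v.1.proj ∈ (chartAt (𝔼 n) p).source) (hw : w.1.proj ∈ (chartAt (𝔼 n) p).source)
    (hζ : ContDiff ℝ 1 ζ) (hζ₀ : ζ 0 = tangentChart p v.1) (hζ₁ : ζ 1 = tangentChart p w.1)
    (hpos : ∀ t ∈ Icc (0 : ℝ) 1,
      (ζ t).1 ∈ (extChartAt (𝓡 n) p).target ∧ 0 < energy (chartMetric n p) (ζ t))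
    (hC : ∀ t ∈ Icc (0 : ℝ) 1, sasakiNorm (unitOfCoord p (ζ t))
      (mfderiv 𝓘(ℝ, ℝ) (𝓡 n).tangent (fun s => unitOfCoord p (ζ s)) t (1 : ℝ)) ≤ C) :
    sasakiEDist v w ≤ ENNReal.ofReal C := by
  have hsmooth : ContMDiffOn 𝓘(ℝ, ℝ) (𝓡 n).tangent 1 (fun t => unitOfCoord p (ζ t)) (Icc 0 1) :=
    fun t ht => ((contMDiffAt_unitOfCoord (hpos t ht).1 (hpos t ht).2).comp t
      hζ.contDiffAt.contMDiffAt).contMDiffWithinAt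
  have hstart : unitOfCoord p (ζ 0) = v.1 := by rw [hζ₀, unitOfCoord_tangentChart hv]
  have hend : unitOfCoord p (ζ 1) = w.1 := by rw [hζ₁, unitOfCoord_tangentChart hw]
  refine (iInf₂_le (fun t => unitOfCoord p (ζ t))
    ⟨hsmooth, fun t ht => norm_unitOfCoord (hpos t ht).2, hstart, hend⟩).trans ?_
  calc sasakiLength (fun t => unitOfCoord p (ζ t))
      ≤ ∫⁻ _ in Icc (0 : ℝ) 1, ENNReal.ofReal C :=
        setLIntegral_mono measurable_const fun t ht => ENNReal.ofReal_le_ofReal (hC t ht)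
    _ = ENNReal.ofReal C := by simp

theorem exists_sasakiEDist_le (v : UnitTangentBundle n M) : ∃ C, ∀ᶠ w in 𝓝 v, sasakiEDist v w ≤
    ENNReal.ofReal (C * ‖tangentChart v.1.proj w.1 - tangentChart v.1.proj v.1‖) := by
  set p := v.1.proj
  set z₀ := tangentChart p v.1
  have hv : p ∈ (chartAt (𝔼 n) p).source := mem_chart_source _ p
  have hz₀ : z₀.1 ∈ (extChartAt (𝓡 n) p).target := mem_extChartAt_target p
  have hpos₀ : 0 < energy (chartMetric n p) z₀ := by
    rw [energy_tangentChart_of_unit hv]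
    exact one_pos
  obtain ⟨C, hC⟩ := exists_sasakiNorm_unitOfCoord_le hz₀ hpos₀
  obtain ⟨ρ, hρ, hball⟩ := Metric.mem_nhds_iff.1 ((eventually_energy_pos hz₀ hpos₀).and hC)
  refine ⟨C, ?_⟩
  filter_upwards [(continuousAt_tangentChart v).preimage_mem_nhds (Metric.ball_mem_nhds z₀ hρ),
    (continuous_foot n M).continuousAt.preimage_mem_nhds (chart_source_mem_nhds (𝔼 n) p)]
    with w hwρ hw
  let ζ : ℝ → 𝔼 n × 𝔼 n := AffineMap.lineMap z₀ (tangentChart p w.1)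
  have hζ : ∀ t ∈ Icc (0 : ℝ) 1, ζ t ∈ Metric.ball z₀ ρ := fun t ht =>
    (convex_ball z₀ ρ).lineMap_mem (Metric.mem_ball_self hρ) hwρ ht
  exact sasakiEDist_le_of_segment hv hw (AffineMap.contDiff_lineMap _ _)
    (AffineMap.lineMap_apply_zero _ _) (AffineMap.lineMap_apply_one _ _)
    (fun t ht => (hball (hζ t ht)).1)
    fun t ht => (hball (hζ t ht)).2 ζ t _ rfl AffineMap.hasDerivAt_lineMap

theorem eventually_sasakiEDist_lt (v : UnitTangentBundle n M) {δ : ℝ≥0∞} (hδ : 0 < δ) :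
    ∀ᶠ w in 𝓝 v, sasakiEDist v w < δ := by
  obtain ⟨C, hC⟩ := exists_sasakiEDist_le v
  have hcont : ContinuousAt (fun w : UnitTangentBundle n M =>
      ENNReal.ofReal (C * ‖tangentChart v.1.proj w.1 - tangentChart v.1.proj v.1‖)) v :=
    ENNReal.continuous_ofReal.continuousAt.comp
      (continuousAt_const.mul ((continuousAt_tangentChart v).sub continuousAt_const).norm)
  have hlt := hcont.eventually_lt_const
    (show ENNReal.ofReal (C * ‖tangentChart v.1.proj v.1 - tangentChart v.1.proj v.1‖) < δ by
      rwa [sub_self, norm_zero, mul_zero, ENNReal.ofReal_zero])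
  filter_upwards [hC, hlt] with w hw hwδ
  exact hw.trans_lt hwδ

end SasakiTopology

section LocallyBounded

variable {X : Type*} [TopologicalSpace X] {S : Set X}

theorem exists_le_of_isCompact {f : X → ℝ≥0∞} (hS : IsCompact S)
    (hf : ∀ x ∈ S, ∃ C < ⊤, ∀ᶠ y in 𝓝 x, f y ≤ C) : ∃ C < ⊤, ∀ x ∈ S, f x ≤ C := by
  refine hS.induction_on (p := fun s => ∃ C < ⊤, ∀ x ∈ s, f x ≤ C)
    ⟨0, ENNReal.zero_lt_top, fun x hx => hx.elim⟩
    (fun s t hst ⟨C, hC, hle⟩ => ⟨C, hC, fun x hx => hle x (hst hx)⟩)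
    (fun s t ⟨C, hC, hs⟩ ⟨C', hC', ht⟩ => ⟨max C C', max_lt hC hC', ?_⟩) fun x hx => ?_
  · rintro x (hx | hx)
    exacts [(hs x hx).trans (le_max_left _ _), (ht x hx).trans (le_max_right _ _)]
  · obtain ⟨C, hC, hle⟩ := hf x hx
    exact ⟨_, mem_nhdsWithin_of_mem_nhds hle, C, hC, fun y hy => hy⟩

variable {Y : Type*} [PseudoEMetricSpace Y] {f : X → Y}

theorem isClopen_edist_lt_top (hf : ∀ x, ∃ C < ⊤, ∀ᶠ y in 𝓝 x, edist (f x) (f y) ≤ C) (b : Y) :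
    IsClopen {x | edist b (f x) < ⊤} := by
  have hnear : ∀ x, ∀ᶠ y in 𝓝 x, edist (f x) (f y) < ⊤ := fun x => by
    obtain ⟨C, hC, hle⟩ := hf x
    exact hle.mono fun y hy => hy.trans_lt hC
  constructor
  · refine ⟨isOpen_iff_mem_nhds.2 fun x hx => (hnear x).mono fun y hy hby => hx ?_⟩
    exact (edist_triangle_right _ _ (f y)).trans_lt (ENNReal.add_lt_top.2 ⟨hby, hy⟩)
  · refine isOpen_iff_mem_nhds.2 fun x hx => (hnear x).mono fun y hy => ?_
    exact (edist_triangle _ (f x) _).trans_lt (ENNReal.add_lt_top.2 ⟨hx, hy⟩)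

theorem ediam_image_lt_top (hf : ∀ x, ∃ C < ⊤, ∀ᶠ y in 𝓝 x, edist (f x) (f y) ≤ C)
    (hS : IsCompact S) (hS' : IsPreconnected S) : Metric.ediam (f '' S) < ⊤ := by
  rcases S.eq_empty_or_nonempty with rfl | ⟨a, ha⟩
  · simp
  have hself : edist (f a) (f a) < ⊤ := (edist_self _).trans_lt ENNReal.zero_lt_top
  have hfin : ∀ x ∈ S, edist (f a) (f x) < ⊤ :=
    hS'.subset_isClopen (isClopen_edist_lt_top hf (f a)) ⟨a, ha, hself⟩
  obtain ⟨C, hC, hle⟩ := exists_le_of_isCompact (f := fun x => edist (f a) (f x)) hS fun x hx => by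
    obtain ⟨C, hC, hle⟩ := hf x
    refine ⟨edist (f a) (f x) + C, ENNReal.add_lt_top.2 ⟨hfin x hx, hC⟩, hle.mono fun y hy => ?_⟩
    exact (edist_triangle _ (f x) _).trans (by gcongr)
  refine (Metric.ediam_image_le_iff.2 fun x hx y hy => ?_).trans_lt
    (ENNReal.add_lt_top.2 ⟨hC, hC⟩)
  exact (edist_triangle_left _ _ (f a)).trans (add_le_add (hle x hx) (hle y hy))

end LocallyBounded

section Spheres

theorem iSup_ediam_sphere_eq_top {X : Type*} [PseudoMetricSpace X] {γ : ℝ → X}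
    (hγ : Isometry γ) : ⨆ r, Metric.ediam (Metric.sphere (γ 0) r) = ⊤ := by
  refine ENNReal.eq_top_of_forall_nnreal_le fun r => le_iSup_of_le (r : ℝ) ?_
  have hpos : γ r ∈ Metric.sphere (γ 0) r := by simp [hγ.dist_eq]
  have hneg : γ (-r) ∈ Metric.sphere (γ 0) r := by simp [hγ.dist_eq]
  refine le_trans ?_ (Metric.edist_le_ediam_of_mem hpos hneg)
  rw [hγ.edist_eq, edist_dist, Real.dist_eq, sub_neg_eq_add, ← ENNReal.ofReal_coe_nnreal]
  exact ENNReal.ofReal_le_ofReal ((le_add_of_nonneg_right r.2).trans (le_abs_self _))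

variable {n : ℕ} {M : Type*} [MetricSpace M] [ChartedSpace (𝔼 n) M] [IsManifold (𝓡 n) ∞ M]
  [RiemannianBundle (fun x : M => TangentSpace (𝓡 n) x)]

theorem eventually_mem_image_unitOfCoord (p : M) {N : Set (𝔼 n)}
    (hN : N ∈ 𝓝 (extChartAt (𝓡 n) p p)) :
    ∀ᶠ x in 𝓝 p, ∀ v : UnitTangentBundle n M, v.1.proj = x →
      v.1 ∈ unitOfCoord p '' (N ×ˢ Metric.sphere 0 1) := by
  filter_upwards [chart_source_mem_nhds (𝔼 n) p,
    (continuousAt_extChartAt (I := 𝓡 n) p).preimage_mem_nhds hN] with x hx hxN v hv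
  subst hv
  set u := tangentCoord p v.1
  have hu : u ≠ 0 := fun hu => by
    have henergy := energy_tangentChart_of_unit hx
    rw [energy, show (tangentChart p v.1).2 = 0 from hu, map_zero] at henergy
    exact zero_ne_one henergy
  refine ⟨(extChartAt (𝓡 n) p v.1.proj, ‖u‖⁻¹ • u), ⟨hxN, ?_⟩, ?_⟩
  · rw [mem_sphere_zero_iff_norm, norm_smul, norm_inv, norm_norm,
      inv_mul_cancel₀ (norm_ne_zero_iff.2 hu)]
  · rw [unitOfCoord, normalizeFiber_smul _ (inv_pos.2 (norm_pos_iff.2 hu))]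
    exact unitOfCoord_tangentChart hx

variable [IsContMDiffRiemannianBundle (𝓡 n) ∞ (𝔼 n) (fun x : M => TangentSpace (𝓡 n) x)]

theorem exists_isCompact_isPreconnected_unit (hn : 2 ≤ n) (p : M) :
    ∃ S : Set (UnitTangentBundle n M), IsCompact S ∧ IsPreconnected S ∧
      ∀ᶠ x in 𝓝 p, ∀ v : UnitTangentBundle n M, v.1.proj = x → v ∈ S := by
  obtain ⟨ρ, hρ, hball⟩ := Metric.nhds_basis_closedBall.mem_iff.1
    (extChartAt_target_mem_nhds (I := 𝓡 n) p)
  let K : Set (𝔼 n × 𝔼 n) := Metric.closedBall (extChartAt (𝓡 n) p p) ρ ×ˢ Metric.sphere 0 1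
  have hcompact : IsCompact K := (isCompact_closedBall _ _).prod (isCompact_sphere _ _)
  have hrank : 1 < Module.rank ℝ (𝔼 n) := by
    rw [← Module.finrank_eq_rank, finrank_euclideanSpace_fin]
    exact_mod_cast hn
  have hconnected : IsPreconnected K :=
    (convex_closedBall _ _).isPreconnected.prod (isPreconnected_sphere hrank 0 1)
  have hpos : ∀ z ∈ K, 0 < energy (chartMetric n p) z := fun z hz =>
    chartMetric_pos (hball hz.1) (ne_zero_of_mem_unit_sphere ⟨z.2, hz.2⟩)
  let ψ : K → UnitTangentBundle n M := fun z => ⟨unitOfCoord p z, norm_unitOfCoord (hpos z z.2)⟩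
  have hψ : Continuous ψ := by
    have hcont : ContinuousOn (unitOfCoord p) K := fun z hz =>
      (contMDiffAt_unitOfCoord (hball hz.1) (hpos z hz)).continuousAt.continuousWithinAt
    exact hcont.domRestrict.subtype_mk _
  refine ⟨range ψ, ?_, ?_, ?_⟩
  · have := isCompact_iff_compactSpace.1 hcompact
    exact isCompact_range hψ
  · have := Subtype.preconnectedSpace hconnected
    exact isPreconnected_range hψ
  · filter_upwards [eventually_mem_image_unitOfCoord (n := n) p (Metric.closedBall_mem_nhds _ hρ)]
      with x hx v hv
    obtain ⟨z, hz, hzv⟩ := hx v hv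
    exact ⟨⟨z, hz⟩, Subtype.ext hzv⟩

variable [IsRiemannianManifold (𝓡 n) M]
  {Φ : ℝ → UnitTangentBundle n M → UnitTangentBundle n M}

theorem PointwiseEquicontinuous.exists_dist_proj_le
    (hequi : PointwiseEquicontinuous sasakiEDist Φ) (v : UnitTangentBundle n M) :
    ∃ C, ∀ᶠ w in 𝓝 v, ∀ t, dist (Φ t v).1.proj (Φ t w).1.proj ≤ C := by
  obtain ⟨δ, hδ, hΦδ⟩ := hequi v 1 one_pos
  refine ⟨1, (eventually_sasakiEDist_lt v hδ).mono fun w hw t => ?_⟩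
  rw [← ENNReal.ofReal_le_one, ← edist_dist]
  exact (edist_proj_le_sasakiEDist _ _).trans (hΦδ w hw t).le

theorem IsGeodesicFlow.sphere_subset (hΦ : IsGeodesicFlow Φ) (x : M) {r : ℝ} (hr : 0 < r) :
    Metric.sphere x r ⊆ (fun v => (Φ r v).1.proj) '' {v : UnitTangentBundle n M | v.1.proj = x} :=
  fun y hy => by
  rw [Metric.mem_sphere'] at hy
  exact hy ▸ hΦ.exists_proj_eq (dist_pos.1 (hy ▸ hr))

theorem IsGeodesicFlow.exists_iSup_ediam_sphere_le (hn : 2 ≤ n) (hΦ : IsGeodesicFlow Φ)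
    (hbdd : ∀ v, ∃ C, ∀ᶠ w in 𝓝 v, ∀ t, dist (Φ t v).1.proj (Φ t w).1.proj ≤ C) (p : M) :
    ∃ C < ⊤, ∀ᶠ x in 𝓝 p, ⨆ r, Metric.ediam (Metric.sphere x r) ≤ C := by
  obtain ⟨S, hcompact, hconnected, hS⟩ := exists_isCompact_isPreconnected_unit hn p
  let orbit : UnitTangentBundle n M → UniformFun ℝ M :=
    fun v => UniformFun.ofFun fun t => (Φ t v).1.proj
  have horbit : ∀ v, ∃ C < ⊤, ∀ᶠ w in 𝓝 v, edist (orbit v) (orbit w) ≤ C := fun v => by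
    obtain ⟨C, hC⟩ := hbdd v
    refine ⟨ENNReal.ofReal C, ENNReal.ofReal_lt_top, hC.mono fun w hw => ?_⟩
    exact UniformFun.edist_le.2 fun t => (edist_dist _ _).trans_le (ENNReal.ofReal_le_ofReal (hw t))
  refine ⟨_, ediam_image_lt_top horbit hcompact hconnected, hS.mono fun x hx => ?_⟩
  refine iSup_le fun r => Metric.ediam_le fun y hy z hz => ?_
  rcases le_or_gt r 0 with hr | hr
  · rw [(Metric.subsingleton_sphere x hr) hy hz, edist_self]
    exact zero_le
  · obtain ⟨v, hv, rfl⟩ := hΦ.sphere_subset x hr hy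
    obtain ⟨w, hw, rfl⟩ := hΦ.sphere_subset x hr hz
    exact (UniformFun.edist_eval_le (x := r)).trans (Metric.edist_le_ediam_of_mem
      (mem_image_of_mem orbit (hx v hv)) (mem_image_of_mem orbit (hx w hw)))

end Spheres

end RiemGeom

end

theorem corollary6p4_general (n : ℕ) (hn : 2 ≤ n)
    (M : Type*) [MetricSpace M] [ChartedSpace (EuclideanSpace ℝ (Fin n)) M]
    [IsManifold (𝓡 n) ∞ M] [RiemannianBundle (fun x : M => TangentSpace (𝓡 n) x)]
    [IsContMDiffRiemannianBundle (𝓡 n) ∞ (EuclideanSpace ℝ (Fin n))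
      (fun x : M => TangentSpace (𝓡 n) x)]
    [IsRiemannianManifold (𝓡 n) M]
    (Φ : ℝ → RiemGeom.UnitTangentBundle n M → RiemGeom.UnitTangentBundle n M)
    (hΦ : RiemGeom.IsGeodesicFlow Φ)
    (hbdd : ∀ v, ∃ C, ∀ᶠ w in 𝓝 v, ∀ t, dist (Φ t v).1.proj (Φ t w).1.proj ≤ C) :
    (¬ ∃ γ : ℝ → M, RiemGeom.IsLine n γ) ∧
    ∃ C : M → ℝ,
      (∀ (x : M) (r : ℝ), Metric.ediam (Metric.sphere x r) ≤ ENNReal.ofReal (C x)) ∧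
      ∀ K : Set M, IsCompact K → BddAbove (C '' K) := by
  have hloc := hΦ.exists_iSup_ediam_sphere_le hn hbdd
  have hfin : ∀ x : M, ⨆ r, Metric.ediam (Metric.sphere x r) < ⊤ := fun x => by
    obtain ⟨C, hC, hle⟩ := hloc x
    exact hle.self_of_nhds.trans_lt hC
  refine ⟨fun ⟨γ, _, hγ⟩ =>
      (hfin (γ 0)).ne (RiemGeom.iSup_ediam_sphere_eq_top (Isometry.of_dist_eq hγ)),
    fun x => (⨆ r, Metric.ediam (Metric.sphere x r)).toReal, fun x r => ?_, fun K hK => ?_⟩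
  · rw [ENNReal.ofReal_toReal (hfin x).ne]
    exact le_iSup (fun r => Metric.ediam (Metric.sphere x r)) r
  · obtain ⟨C, hC, hle⟩ := RiemGeom.exists_le_of_isCompact hK fun x _ => hloc x
    exact ⟨C.toReal, forall_mem_image.2 fun x hx => ENNReal.toReal_mono hC.ne (hle x hx)⟩

theorem corollary6p4 (n : ℕ) (hn : 2 ≤ n)
    (M : Type*) [MetricSpace M] [ChartedSpace (EuclideanSpace ℝ (Fin n)) M]
    [IsManifold (𝓡 n) ∞ M] [RiemannianBundle (fun x : M => TangentSpace (𝓡 n) x)]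
    [IsContMDiffRiemannianBundle (𝓡 n) ∞ (EuclideanSpace ℝ (Fin n))
      (fun x : M => TangentSpace (𝓡 n) x)]
    [IsRiemannianManifold (𝓡 n) M] [ConnectedSpace M] [NoncompactSpace M]
    (Φ : ℝ → RiemGeom.UnitTangentBundle n M → RiemGeom.UnitTangentBundle n M)
    (hΦ : RiemGeom.IsGeodesicFlow Φ)
    (hequi : RiemGeom.PointwiseEquicontinuous RiemGeom.sasakiEDist Φ) :
    (¬ ∃ γ : ℝ → M, RiemGeom.IsLine n γ) ∧
    ∃ C : M → ℝ,
      (∀ (x : M) (r : ℝ), Metric.ediam (Metric.sphere x r) ≤ ENNReal.ofReal (C x)) ∧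
      ∀ K : Set M, IsCompact K → BddAbove (C '' K) :=
  corollary6p4_general n hn M Φ hΦ hequi.exists_dist_proj_le
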